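/- Conventions. A drawing of a finite graph $G$ in the plane represents the vertices by distinct points and each edge by a curve (a continuous image of $[0,1]$) joining its two end-vertices and containing no other vertex, such that any two edges have finitely many common points, each edge has finitely many self-intersections, every point that is not a vertex lies on at most two strands of edges, and strands meeting at such a point cross there (no tangencies). Edges may cross repeatedly and may cross themselves. The drawing is *simple* if no edge intersects itself and any two edges have at most one common point. It is *circular* if the vertices lie on the boundary circle of a disk and the edges run inside the disk. Let $I(D)$ be the set of intersection points of the edges of a drawing $D$, not including the vertices. A *bundled crossing* of $D$ is a nonempty set $B$ consisting of the points of $I(D)$ in a region $R$ such that the edge pieces cut out by $R$ (each of which is an arc or a point) can be partitioned into two sets (bundles) $E_1,E_2$ with the following properties: each piece in $E_1$ has exactly one point in common with each piece in $E_2$, and this point is in $I(D)$; no two pieces in the same bundle have a common point; and either $R$ is a closed Jordan region whose boundary consists of four pieces $\tilde e_1,\tilde e_2,\tilde e_3,\tilde e_4$ in this cyclic order with $\tilde e_1,\tilde e_3\in E_1$ and $\tilde e_2,\tilde e_4\in E_2$, or, in the degenerate case, one of the bundles consists of a single piece, $R$ is this piece (an arc, or a single point), and its two ends lie on pieces of the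 other bundle. A *bundling* of $D$ is a partition of $I(D)$ into bundled crossings. The *simple circular bundled crossing number* $\mathrm{bc}^\circ(G)$ is the smallest number of bundled crossings over all bundlings of all simple circular drawings of $G$; the *non-simple circular bundled crossing number* $\mathrm{bc}^{\circ\prime}(G)$ is the same minimum over all circular drawings of $G$, simple or not. Statement. $\mathrm{bc}^{\circ\prime}(K_{3,3})=1$, but $\mathrm{bc}^\circ(K_{3,3})>1$. -/

import Mathlib

open Set Topology unitInterval

/-- Two continuous curves cross at the parameters `s` and `t`: they meet there, and a local
homeomorphism of the plane around the common point straightens the first curve near `s` to the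
real axis and the second curve near `t` to the imaginary axis. -/
def CurvesCrossAt (c c' : C(I, ℂ)) (s t : I) : Prop :=
  c s = c' t ∧ ∃ φ : OpenPartialHomeomorph ℂ ℂ, c s ∈ φ.source ∧ φ (c s) = 0 ∧
    (∀ᶠ u in 𝓝 s, (φ (c u)).im = 0) ∧ (∀ᶠ v in 𝓝 t, (φ (c' v)).re = 0)

/-- A (not necessarily simple) drawing of a graph in the plane `ℂ`. Edges may cross each other
several times and may cross themselves. -/
structure GraphDrawing {V : Type*} (G : SimpleGraph V) where
  /-- the point representing a vertex -/
  pos : V → ℂ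
  pos_injective : Function.Injective pos
  /-- the curve representing an edge -/
  curve : G.edgeSet → C(I, ℂ)
  /-- the curve of an edge joins the two end-vertices of the edge (in either direction) -/
  curve_ends : ∀ e, s(curve e 0, curve e 1) = Sym2.map pos e.1
  /-- an edge contains no vertices besides its two ends -/
  curve_interior : ∀ e t, t ≠ 0 → t ≠ 1 → curve e t ∉ range pos
  /-- two edges have finitely many common points; an edge meets itself finitely often -/
  finite_common : ∀ e f,
    {x : I × I | (e, x.1) ≠ (f, x.2) ∧ curve e x.1 = curve f x.2}.Finite
  /-- a point that is not a vertex lies on at most two strands of edges -/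
  at_most_two : ∀ p ∉ range pos, {x : G.edgeSet × I | curve x.1 x.2 = p}.encard ≤ 2
  /-- strands of edges that meet outside the vertices cross there (no tangencies) -/
  transversal : ∀ e f s t, (e, s) ≠ (f, t) → curve e s = curve f t →
    curve e s ∉ range pos → CurvesCrossAt (curve e) (curve f) s t

namespace GraphDrawing

variable {V : Type*} {G : SimpleGraph V}

/-- The set `I(D)` of intersection points among the edges, vertices excluded
(self-intersections of edges are included). -/
def crossings (D : GraphDrawing G) : Set ℂ :=
  {p | p ∉ range D.pos ∧ ∃ x y : G.edgeSet × I, x ≠ y ∧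
    D.curve x.1 x.2 = p ∧ D.curve y.1 y.2 = p}

/-- A drawing is simple if no edge meets itself and any two edges have at most one point in
common. -/
def IsSimple (D : GraphDrawing G) : Prop :=
  (∀ e, Function.Injective (D.curve e)) ∧
    ∀ e f, e ≠ f → (range (D.curve e) ∩ range (D.curve f)).Subsingleton

/-- A drawing is circular if the vertices lie on the boundary of the unit disk and the edges run
inside the disk. -/
def IsCircular (D : GraphDrawing G) : Prop :=
  (∀ v, D.pos v ∈ Metric.sphere (0 : ℂ) 1) ∧
    ∀ e t, t ≠ 0 → t ≠ 1 → D.curve e t ∈ Metric.ball (0 : ℂ) 1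

/-- The pieces of the edges cut out by a set `R`: pairs consisting of an edge and a connected
component of the set of parameters at which the curve of the edge is in `R`. -/
def pieces (D : GraphDrawing G) (R : Set ℂ) : Set (G.edgeSet × Set I) :=
  {a | ∃ t ∈ D.curve a.1 ⁻¹' R, a.2 = connectedComponentIn (D.curve a.1 ⁻¹' R) t}

/-- The points of an edge piece. -/
def trace (D : GraphDrawing G) (a : G.edgeSet × Set I) : Set ℂ :=
  D.curve a.1 '' a.2

/-- `R` is a closed Jordan region, i.e. a homeomorphic image of the closed square, whose boundary
consists of the edge pieces `a₁`, `a₂`, `a₃`, `a₄`, in this cyclic order. -/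
def IsJordanFrame (D : GraphDrawing G) (R : Set ℂ) (a₁ a₂ a₃ a₄ : G.edgeSet × Set I) : Prop :=
  ∃ h : C(I × I, ℂ), Function.Injective h ∧ range h = R ∧
    h '' {x | x.1 = 0} = D.trace a₁ ∧ h '' {x | x.2 = 0} = D.trace a₂ ∧
    h '' {x | x.1 = 1} = D.trace a₃ ∧ h '' {x | x.2 = 1} = D.trace a₄

/-- The degenerate form of the region: `R` is the arc (possibly a single point) formed by one edge
piece `a₁ = a₃`, beginning at a point of `a₂` and ending at a point of `a₄`. -/
def IsDegenerateFrame (D : GraphDrawing G) (R : Set ℂ) (a₁ a₂ a₃ a₄ : G.edgeSet × Set I) :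
    Prop :=
  a₁ = a₃ ∧ R = D.trace a₁ ∧ ∃ s t, s ≤ t ∧ a₁.2 = Icc s t ∧
    D.curve a₁.1 s ∈ D.trace a₂ ∧ D.curve a₁.1 t ∈ D.trace a₄

/-- `B` is a bundled crossing of `D`: it consists of the crossings in a region `R`, and the edge
pieces cut out by `R` form two bundles `E₁` and `E₂` such that each piece of `E₁` meets each piece
of `E₂` in exactly one point, which is a crossing, no two pieces of the same bundle meet, and `R`
is framed by two pieces of `E₁` and two pieces of `E₂`. In the degenerate case a bundle consists
of a single piece; this bundle is called `E₁`. -/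
def IsBundledCrossing (D : GraphDrawing G) (B : Set ℂ) : Prop :=
  ∃ (R : Set ℂ) (E₁ E₂ : Set (G.edgeSet × Set I)),
    B = D.crossings ∩ R ∧
    D.pieces R = E₁ ∪ E₂ ∧ Disjoint E₁ E₂ ∧
    (∀ a ∈ D.pieces R, InjOn (D.curve a.1) a.2) ∧
    (∀ a ∈ E₁, ∀ b ∈ E₂, ∃ p ∈ D.crossings, D.trace a ∩ D.trace b = {p}) ∧
    E₁.PairwiseDisjoint D.trace ∧ E₂.PairwiseDisjoint D.trace ∧
    ∃ a₁ ∈ E₁, ∃ a₂ ∈ E₂, ∃ a₃ ∈ E₁, ∃ a₄ ∈ E₂,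
      D.IsJordanFrame R a₁ a₂ a₃ a₄ ∨ D.IsDegenerateFrame R a₁ a₂ a₃ a₄

/-- A bundling of `D`: a partition of the set of crossings into finitely many bundled
crossings. -/
def IsBundling (D : GraphDrawing G) (P : Finset (Set ℂ)) : Prop :=
  (∀ B ∈ P, B.Nonempty ∧ D.IsBundledCrossing B) ∧
    (P : Set (Set ℂ)).PairwiseDisjoint id ∧ ⋃₀ (P : Set (Set ℂ)) = D.crossings

end GraphDrawing

/-- The circular bundled crossing number of a graph: the smallest number of bundled crossings over
all bundlings of all simple circular drawings. -/
noncomputable def circularBundledCrossingNumber {V : Type*} (G : SimpleGraph V) : ℕ :=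
  sInf {k | ∃ D : GraphDrawing G, D.IsSimple ∧ D.IsCircular ∧
    ∃ P : Finset (Set ℂ), D.IsBundling P ∧ P.card = k}

/-- The non-simple circular bundled crossing number of a graph: the smallest number of bundled
crossings over all bundlings of all circular drawings, simple or not. -/
noncomputable def nonsimpleCircularBundledCrossingNumber {V : Type*} (G : SimpleGraph V) : ℕ :=
  sInf {k | ∃ D : GraphDrawing G, D.IsCircular ∧
    ∃ P : Finset (Set ℂ), D.IsBundling P ∧ P.card = k}

section AlternatingCurves

/-! ### Curves in a disk with alternating ends: a winding argument -/

/-- Two continuous functions whose exponentials are proportional have the same increments. -/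
theorem sub_eq_sub_of_exp_eq_mul_exp {L M : ℝ → ℂ} (hL : Continuous L) (hM : Continuous M)
    {a : ℂ} (h : ∀ t, Complex.exp (L t) = a * Complex.exp (M t)) (t₀ t₁ : ℝ) :
    L t₁ - L t₀ = M t₁ - M t₀ := by
  -- Both sides lift the same curve through the covering `exp` and agree at `t₀`.
  have key : L = fun t => M t + (L t₀ - M t₀) := by
    refine Complex.isCoveringMap_exp.eq_of_comp_eq hL (by fun_prop) ?_ t₀ (by ring)
    funext t
    apply Subtype.ext
    simp only [Function.comp_apply]
    rw [Complex.exp_add, Complex.exp_sub, h t, h t₀]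
    field_simp [Complex.exp_ne_zero]
  rw [congrFun key t₁]; ring

/-- The argument of `1 - exp (i δ)` for `0 < δ < 2π`. -/
theorem arg_one_sub_exp {δ : ℝ} (h₀ : 0 < δ) (h₁ : δ < 2 * Real.pi) :
    Complex.arg (1 - Complex.exp (δ * Complex.I)) = (δ - Real.pi) / 2 := by
  have hs : 0 < Real.sin (δ / 2) := Real.sin_pos_of_pos_of_lt_pi (by linarith) (by linarith)
  have e : 1 - Complex.exp (δ * Complex.I) = ((2 * Real.sin (δ / 2) : ℝ) : ℂ) *
      (Complex.cos ((δ - Real.pi) / 2 : ℝ) + Complex.sin ((δ - Real.pi) / 2 : ℝ) * Complex.I) := by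
    have h1 : (δ - Real.pi) / 2 = δ / 2 - Real.pi / 2 := by ring
    have h2 : δ = 2 * (δ / 2) := by ring
    rw [h1, ← Complex.ofReal_cos, ← Complex.ofReal_sin, Real.cos_sub_pi_div_two,
      Real.sin_sub_pi_div_two, Complex.exp_mul_I, ← Complex.ofReal_cos, ← Complex.ofReal_sin]
    conv_lhs => rw [h2, Real.cos_two_mul', Real.sin_two_mul]
    have := Real.sin_sq_add_cos_sq (δ / 2)
    generalize Real.sin (δ / 2) = x at this ⊢
    generalize Real.cos (δ / 2) = y at this ⊢
    apply Complex.ext <;> simp [-Complex.ofReal_pow]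
    linarith
  rw [e, Complex.arg_mul_cos_add_sin_mul_I (by linarith)]
  constructor <;> linarith [Real.pi_pos]

/-- The argument of `1 - exp (- i δ)` for `0 < δ < 2π`. -/
theorem arg_one_sub_exp_neg {δ : ℝ} (h₀ : 0 < δ) (h₁ : δ < 2 * Real.pi) :
    Complex.arg (1 - Complex.exp ((-δ : ℝ) * Complex.I)) = (Real.pi - δ) / 2 := by
  have e : ((-δ : ℝ) : ℂ) * Complex.I = (2 * Real.pi - δ : ℝ) * Complex.I - 2 * Real.pi * Complex.I := by
    push_cast; ring
  rw [e, Complex.exp_sub, Complex.exp_two_pi_mul_I, div_one,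
    arg_one_sub_exp (by linarith) (by linarith)]
  ring

/-- The closed unit disk, punctured at a point `a` of its boundary, is seen from `a` in a half
plane. -/
theorem one_sub_conj_mul_mem_slitPlane {a w : ℂ} (ha : ‖a‖ = 1) (hw : ‖w‖ ≤ 1) (h : w ≠ a) :
    1 - starRingEnd ℂ a * w ∈ Complex.slitPlane := by
  -- The real part is positive: `2⟨a, w⟩ = ‖a‖² + ‖w‖² - ‖a - w‖² < 2`.
  left
  have h1 : a.re ^ 2 + a.im ^ 2 = 1 := by
    have := Complex.sq_norm a
    rw [ha, Complex.normSq_apply] at this; nlinarith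
  have h2 : w.re ^ 2 + w.im ^ 2 ≤ 1 := by
    have := Complex.sq_norm w
    rw [Complex.normSq_apply] at this; nlinarith [norm_nonneg w]
  have h3 : 0 < (a.re - w.re) ^ 2 + (a.im - w.im) ^ 2 := by
    by_contra hc
    exact h (Complex.ext (by nlinarith [sq_nonneg (a.re - w.re), sq_nonneg (a.im - w.im)])
      (by nlinarith [sq_nonneg (a.re - w.re), sq_nonneg (a.im - w.im)]))
  simp
  nlinarith

/-- The change of a continuous logarithm of `k * (1 - conj a * w t)`, for a curve `w` in the closed
unit disk that avoids the point `a` of the circle. -/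
theorem im_sub_im_of_exp_eq {L w : ℝ → ℂ} (hL : Continuous L) (hw : Continuous w) {a k : ℂ}
    (ha : ‖a‖ = 1) (hw1 : ∀ t, ‖w t‖ ≤ 1) (hwa : ∀ t, w t ≠ a)
    (h : ∀ t, Complex.exp (L t) = k * (1 - starRingEnd ℂ a * w t)) (t₀ t₁ : ℝ) :
    (L t₁).im - (L t₀).im = Complex.arg (1 - starRingEnd ℂ a * w t₁) -
      Complex.arg (1 - starRingEnd ℂ a * w t₀) := by
  have hs := fun t => one_sub_conj_mul_mem_slitPlane ha (hw1 t) (hwa t)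
  have hM : Continuous fun t => Complex.log (1 - starRingEnd ℂ a * w t) :=
    Continuous.clog (by fun_prop) hs
  have := sub_eq_sub_of_exp_eq_mul_exp hL hM (a := k)
    (fun t => by rw [h, Complex.exp_log (Complex.slitPlane_ne_zero (hs t))]) t₀ t₁
  simpa [Complex.log_im] using congrArg Complex.im this

/-- Two curves in the closed unit disk whose ends alternate on the unit circle meet. -/
theorem exists_eq_of_alternating (c c' : C(I, ℂ)) (hc : ∀ s, ‖c s‖ ≤ 1) (hc' : ∀ t, ‖c' t‖ ≤ 1)
    {α β γ δ : ℝ} (h1 : α < β) (h2 : β < γ) (h3 : γ < δ) (h4 : δ < α + 2 * Real.pi)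
    (hα : c 0 = Complex.exp (α * Complex.I)) (hγ : c 1 = Complex.exp (γ * Complex.I))
    (hβ : c' 0 = Complex.exp (β * Complex.I)) (hδ : c' 1 = Complex.exp (δ * Complex.I)) :
    ∃ s t, c s = c' t := by
  by_contra! hne
  -- Extending the parameters to `ℝ` makes the domain of the nowhere zero difference `c - c'` the
  -- simply connected plane, so it has a global continuous logarithm `L`.
  let p : ℝ → I := projIcc 0 1 zero_le_one
  have hp : Continuous p := continuous_projIcc
  have p0 : p 0 = 0 := projIcc_left _
  have p1 : p 1 = 1 := projIcc_right _
  obtain ⟨L, ⟨-, hL⟩, -⟩ := Complex.isCoveringMapOn_exp.existsUnique_continuousMap_lifts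
    (f := (⟨fun x : ℝ × ℝ => c (p x.1) - c' (p x.2), by fun_prop⟩ : C(ℝ × ℝ, ℂ)))
    (a₀ := (0, 0)) (e₀ := Complex.log (c (p 0) - c' (p 0)))
    (Complex.exp_log (sub_ne_zero.2 (hne _ _))) (fun x => sub_ne_zero.2 (hne _ _))
  have hL' : ∀ s t, Complex.exp (L (s, t)) = c (p s) - c' (p t) := fun s t => congrFun hL (s, t)
  have hn : ∀ x : ℝ, ‖Complex.exp (x * Complex.I)‖ = 1 := Complex.norm_exp_ofReal_mul_I
  have hcj : ∀ x y : ℝ, starRingEnd ℂ (Complex.exp (x * Complex.I)) * Complex.exp (y * Complex.I) =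
      Complex.exp ((y - x : ℝ) * Complex.I) := by
    intro x y
    rw [← Complex.exp_conj, ← Complex.exp_add]
    congr 1
    simp; ring
  have hcs : ∀ x : ℝ, Complex.exp (x * Complex.I) * starRingEnd ℂ (Complex.exp (x * Complex.I)) = 1 := by
    intro x
    rw [mul_comm, hcj]; simp
  -- On each side of the parameter square one curve rests at a point `a` of the circle, so the
  -- difference is `±a * (1 - conj a * w)` and the change of its argument can be read off from the
  -- principal branch.
  have A1 := im_sub_im_of_exp_eq (L := fun t => L (0, t)) (w := fun t => c' (p t)) (by fun_prop)
    (by fun_prop) (hn α) (fun t => hc' _) (fun t => by rw [← hα]; exact (hne _ _).symm)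
    (k := Complex.exp (α * Complex.I))
    (fun t => by rw [hL', p0, hα, mul_sub, ← mul_assoc, hcs]; ring) 0 1
  have A2 := im_sub_im_of_exp_eq (L := fun t => L (1, t)) (w := fun t => c' (p t)) (by fun_prop)
    (by fun_prop) (hn γ) (fun t => hc' _) (fun t => by rw [← hγ]; exact (hne _ _).symm)
    (k := Complex.exp (γ * Complex.I))
    (fun t => by rw [hL', p1, hγ, mul_sub, ← mul_assoc, hcs]; ring) 0 1
  have A3 := im_sub_im_of_exp_eq (L := fun t => L (t, 0)) (w := fun t => c (p t)) (by fun_prop)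
    (by fun_prop) (hn β) (fun t => hc _) (fun t => by rw [← hβ]; exact hne _ _)
    (k := -Complex.exp (β * Complex.I))
    (fun t => by rw [hL', p0, hβ, mul_sub, ← mul_assoc, neg_mul, neg_mul, hcs]; ring) 0 1
  have A4 := im_sub_im_of_exp_eq (L := fun t => L (t, 1)) (w := fun t => c (p t)) (by fun_prop)
    (by fun_prop) (hn δ) (fun t => hc _) (fun t => by rw [← hδ]; exact hne _ _)
    (k := -Complex.exp (δ * Complex.I))
    (fun t => by rw [hL', p1, hδ, mul_sub, ← mul_assoc, neg_mul, neg_mul, hcs]; ring) 0 1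
  simp only [p0, p1, hα, hβ, hγ, hδ, hcj] at A1 A2 A3 A4
  rw [arg_one_sub_exp (by linarith) (by linarith), arg_one_sub_exp (by linarith) (by linarith)] at A1
  rw [arg_one_sub_exp (by linarith) (by linarith), ← neg_sub γ β,
    arg_one_sub_exp_neg (by linarith) (by linarith)] at A2
  rw [arg_one_sub_exp (by linarith) (by linarith), ← neg_sub β α,
    arg_one_sub_exp_neg (by linarith) (by linarith)] at A3
  rw [← neg_sub δ γ, arg_one_sub_exp_neg (by linarith) (by linarith), ← neg_sub δ α,
    arg_one_sub_exp_neg (by linarith) (by linarith)] at A4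
  -- The two ways from `(0, 0)` to `(1, 1)` around the square give changes of the argument that
  -- differ by `2π`.
  linarith [Real.pi_pos]

end AlternatingCurves

/-! ### Combinatorics of alternating edges of `K₃,₃` -/

section AlternatingPairs

/-- The alternation graph of the bichromatic pairs among six points on a line, three of each colour,
is not bipartite. -/
theorem not_bipartite_alternating_of_bool (κ : Fin 6 → Bool)
    (hκ : ∑ i, (κ i).toNat = 3) (col : Fin 6 → Fin 6 → ℕ)
    (H : ∀ i j k l, i < k → k < j → j < l → κ i ≠ κ j → κ k ≠ κ l → col i j + col k l = 1) :
    False := by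
  -- One instance for each of the fifteen sets of four positions.
  have h1 := H 0 2 1 3 (by decide) (by decide) (by decide)
  have h2 := H 0 2 1 4 (by decide) (by decide) (by decide)
  have h3 := H 0 2 1 5 (by decide) (by decide) (by decide)
  have h4 := H 0 3 1 4 (by decide) (by decide) (by decide)
  have h5 := H 0 3 1 5 (by decide) (by decide) (by decide)
  have h6 := H 0 3 2 4 (by decide) (by decide) (by decide)
  have h7 := H 0 3 2 5 (by decide) (by decide) (by decide)
  have h8 := H 0 4 1 5 (by decide) (by decide) (by decide)
  have h9 := H 0 4 2 5 (by decide) (by decide) (by decide)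
  have h10 := H 0 4 3 5 (by decide) (by decide) (by decide)
  have h11 := H 1 3 2 4 (by decide) (by decide) (by decide)
  have h12 := H 1 3 2 5 (by decide) (by decide) (by decide)
  have h13 := H 1 4 2 5 (by decide) (by decide) (by decide)
  have h14 := H 1 4 3 5 (by decide) (by decide) (by decide)
  have h15 := H 2 4 3 5 (by decide) (by decide) (by decide)
  clear H
  simp only [Fin.sum_univ_six] at hκ
  generalize κ 0 = k0 at *
  generalize κ 1 = k1 at *
  generalize κ 2 = k2 at *
  generalize κ 3 = k3 at *
  generalize κ 4 = k4 at *
  generalize κ 5 = k5 at *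
  -- For each of the twenty balanced colourings the equations `x + y = 1` contain an odd cycle,
  -- which forces `2 * x = 1`.
  cases k0 <;> cases k1 <;> cases k2 <;> cases k3 <;> cases k4 <;> cases k5 <;>
    simp at hκ <;> simp at h1 h2 h3 h4 h5 h6 h7 h8 h9 h10 h11 h12 h13 h14 h15 <;> omega

/-- The alternation graph of the edges of `K₃,₃`, for vertices on a line (or a circle), is not
bipartite. -/
theorem not_bipartite_alternating {θ : Fin 3 ⊕ Fin 3 → ℝ} (hθ : Function.Injective θ)
    (col : Sym2 (Fin 3 ⊕ Fin 3) → Bool)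
    (H : ∀ x y z w, x.isLeft ≠ y.isLeft → z.isLeft ≠ w.isLeft → θ x < θ z → θ z < θ y → θ y < θ w →
      col s(x, y) ≠ col s(z, w)) : False := by
  have hcard : (Finset.univ.image θ).card = 6 := by
    rw [Finset.card_image_of_injective _ hθ]; simp
  let o := (Finset.univ.image θ).orderEmbOfFin hcard
  have ho : ∀ i, ∃ v, θ v = o i := fun i => by
    obtain ⟨v, -, hv⟩ := Finset.mem_image.1 (Finset.orderEmbOfFin_mem (Finset.univ.image θ) hcard i)
    exact ⟨v, hv⟩
  choose v hv using ho
  have hlt : ∀ i j, i < j → θ (v i) < θ (v j) := fun i j h => by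
    rw [hv, hv]; exact o.strictMono h
  have hinj : Function.Injective v := fun i j h => o.injective (by rw [← hv, ← hv, h])
  have hbij : Function.Bijective v := (Fintype.bijective_iff_injective_and_card v).2 ⟨hinj, by simp⟩
  refine not_bipartite_alternating_of_bool (fun i => (v i).isLeft) ?_
    (fun i j => (col s(v i, v j)).toNat) ?_
  · rw [hbij.sum_comp (fun x => x.isLeft.toNat)]
    simp
  · intro i j k l h1 h2 h3 h4 h5
    have := H _ _ _ _ h4 h5 (hlt _ _ h1) (hlt _ _ h2) (hlt _ _ h3)
    revert this
    generalize col s(v i, v j) = p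
    generalize col s(v k, v l) = q
    revert p q
    decide

end AlternatingPairs

/-! ### Forced crossings, and the two-colouring given by a single bundled crossing -/

namespace GraphDrawing

variable {V : Type*} {G : SimpleGraph V}

theorem norm_curve_le_one {D : GraphDrawing G} (hD : D.IsCircular) (e : G.edgeSet) (t : I) :
    ‖D.curve e t‖ ≤ 1 := by
  have hpos : ∀ v, ‖D.pos v‖ ≤ 1 := fun v => by
    have := hD.1 v
    rw [mem_sphere_zero_iff_norm] at this
    exact this.le
  have hends : ∀ z ∈ s(D.curve e 0, D.curve e 1), ‖z‖ ≤ 1 := by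
    intro z hz
    rw [D.curve_ends, Sym2.mem_map] at hz
    obtain ⟨v, -, rfl⟩ := hz
    exact hpos v
  by_cases h0 : t = 0
  · subst h0; exact hends _ (by simp)
  by_cases h1 : t = 1
  · subst h1; exact hends _ (by simp)
  · have := hD.2 e t h0 h1
    rw [mem_ball_zero_iff] at this
    exact this.le

/-- The curve of an edge can be traversed in either direction. -/
theorem exists_oriented_curve (D : GraphDrawing G) (e : G.edgeSet) {x y : V} (h : e.1 = s(x, y)) :
    ∃ c : C(I, ℂ), c 0 = D.pos x ∧ c 1 = D.pos y ∧ ∀ s, ∃ s', c s = D.curve e s' := by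
  have := D.curve_ends e
  rw [h, Sym2.map_mk, Sym2.eq_iff] at this
  rcases this with ⟨h0, h1⟩ | ⟨h0, h1⟩
  · exact ⟨D.curve e, h0, h1, fun s => ⟨s, rfl⟩⟩
  · exact ⟨(D.curve e).comp ⟨unitInterval.symm, unitInterval.continuous_symm⟩, by simpa using h1,
      by simpa using h0, fun s => ⟨unitInterval.symm s, rfl⟩⟩

/-- If the curve of an edge passes through a vertex, then this is an end of the edge. -/
theorem mem_of_curve_eq_pos (D : GraphDrawing G) (e : G.edgeSet) {t : I} {v : V}
    (h : D.curve e t = D.pos v) : v ∈ e.1 := by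
  have key : ∀ z ∈ s(D.curve e 0, D.curve e 1), z = D.pos v → v ∈ e.1 := by
    intro z hz hv
    rw [D.curve_ends, Sym2.mem_map] at hz
    obtain ⟨w, hw, rfl⟩ := hz
    rwa [← D.pos_injective hv]
  by_cases h0 : t = 0
  · subst h0; exact key _ (by simp) h
  by_cases h1 : t = 1
  · subst h1; exact key _ (by simp) h
  · exact absurd ⟨v, h.symm⟩ (D.curve_interior e t h0 h1)

/-- In a circular drawing, two edges whose ends alternate on the circle cross. -/
theorem exists_mem_crossings_of_alternating {D : GraphDrawing G} (hD : D.IsCircular)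
    {e f : G.edgeSet} {x y z w : V} (he : e.1 = s(x, y)) (hf : f.1 = s(z, w))
    (h1 : (D.pos x).arg < (D.pos z).arg) (h2 : (D.pos z).arg < (D.pos y).arg)
    (h3 : (D.pos y).arg < (D.pos w).arg) :
    e ≠ f ∧ ∃ s t, D.curve e s = D.curve f t ∧ D.curve e s ∈ D.crossings := by
  have hdisj : ∀ v, v ∈ e.1 → v ∉ f.1 := by
    intro v hv hv'
    rw [he, Sym2.mem_iff] at hv
    rw [hf, Sym2.mem_iff] at hv'
    rcases hv with rfl | rfl <;> rcases hv' with rfl | rfl <;> linarith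
  have hne : e ≠ f := by
    rintro rfl
    exact hdisj x (by rw [he]; simp) (by rw [he]; simp)
  have hexp : ∀ v, D.pos v = Complex.exp ((D.pos v).arg * Complex.I) := fun v => by
    have h := Complex.norm_mul_exp_arg_mul_I (D.pos v)
    rw [mem_sphere_zero_iff_norm.1 (hD.1 v)] at h
    simpa using h.symm
  obtain ⟨c, c0, c1, hc⟩ := D.exists_oriented_curve e he
  obtain ⟨c', c0', c1', hc'⟩ := D.exists_oriented_curve f hf
  obtain ⟨s, t, hst⟩ := exists_eq_of_alternating c c'
    (fun s => by obtain ⟨s', h⟩ := hc s; rw [h]; exact norm_curve_le_one hD _ _)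
    (fun s => by obtain ⟨s', h⟩ := hc' s; rw [h]; exact norm_curve_le_one hD _ _)
    h1 h2 h3 (by linarith [Complex.neg_pi_lt_arg (D.pos x), Complex.arg_le_pi (D.pos w)])
    (by rw [c0, ← hexp]) (by rw [c1, ← hexp]) (by rw [c0', ← hexp]) (by rw [c1', ← hexp])
  obtain ⟨s', hs'⟩ := hc s
  obtain ⟨t', ht'⟩ := hc' t
  have heq : D.curve e s' = D.curve f t' := by rw [← hs', ← ht', hst]
  refine ⟨hne, s', t', heq, ?_, (e, s'), (f, t'), fun h => hne (congrArg Prod.fst h), rfl, heq.symm⟩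
  rintro ⟨v, hv⟩
  exact hdisj v (D.mem_of_curve_eq_pos e hv.symm) (D.mem_of_curve_eq_pos f (by rw [← heq, hv]))

/-- In a circular drawing of `K₃,₃` the edges cannot be coloured with two colours so that crossing
edges have different colours. -/
theorem not_bipartite_crossings {D : GraphDrawing (completeBipartiteGraph (Fin 3) (Fin 3))}
    (hD : D.IsCircular) (col : (completeBipartiteGraph (Fin 3) (Fin 3)).edgeSet → Prop)
    (H : ∀ e f s t, e ≠ f → D.curve e s = D.curve f t → D.curve e s ∈ D.crossings →
      (col e ↔ ¬ col f)) : False := by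
  classical
  have hadj : ∀ x y : Fin 3 ⊕ Fin 3, x.isLeft ≠ y.isLeft →
      s(x, y) ∈ (completeBipartiteGraph (Fin 3) (Fin 3)).edgeSet := by
    rintro (x | x) (y | y) h <;> simp at h ⊢
  refine not_bipartite_alternating (θ := fun v => (D.pos v).arg) ?_
    -- Pairs that are not edges get a dummy colour; only pairs of vertices from different sides are
    -- ever compared.
    (fun u => if h : u ∈ (completeBipartiteGraph (Fin 3) (Fin 3)).edgeSet then
      decide (col ⟨u, h⟩) else false) ?_
  · intro v w h
    apply D.pos_injective
    apply Complex.ext_norm_arg _ h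
    rw [mem_sphere_zero_iff_norm.1 (hD.1 v), mem_sphere_zero_iff_norm.1 (hD.1 w)]
  · intro x y z w hxy hzw h1 h2 h3
    obtain ⟨hne, s, t, hst, hmem⟩ := exists_mem_crossings_of_alternating hD
      (e := ⟨_, hadj x y hxy⟩) (f := ⟨_, hadj z w hzw⟩) rfl rfl h1 h2 h3
    have := H _ _ s t hne hst hmem
    simp only [hadj x y hxy, hadj z w hzw, dif_pos]
    by_cases hc : col ⟨_, hadj z w hzw⟩ <;> simp [hc, this]

/-- Without crossings a constant colouring would be proper. -/
theorem crossings_nonempty {D : GraphDrawing (completeBipartiteGraph (Fin 3) (Fin 3))}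
    (hD : D.IsCircular) : D.crossings.Nonempty := by
  by_contra h
  rw [not_nonempty_iff_eq_empty] at h
  exact not_bipartite_crossings hD (fun _ => True) (fun e f s t _ _ hm => by simp [h] at hm)

theorem card_ne_zero_of_isBundling {D : GraphDrawing (completeBipartiteGraph (Fin 3) (Fin 3))}
    (hD : D.IsCircular) {P : Finset (Set ℂ)} (hP : D.IsBundling P) : P.card ≠ 0 := by
  intro h
  rw [Finset.card_eq_zero] at h
  have := crossings_nonempty hD
  rw [← hP.2.2, h] at this
  simp at this

/-- The pieces of an edge that does not meet itself belong to only one of two bundles. -/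
theorem IsSimple.not_mem_of_mem_bundle {D : GraphDrawing G} (hD : D.IsSimple) {R : Set ℂ}
    {E₁ E₂ : Set (G.edgeSet × Set I)} (hR : D.pieces R = E₁ ∪ E₂) (hE : Disjoint E₁ E₂)
    (hcross : ∀ a ∈ E₁, ∀ b ∈ E₂, ∃ p ∈ D.crossings, D.trace a ∩ D.trace b = {p})
    {e : G.edgeSet} {J K : Set I} (hJ : (e, J) ∈ E₁) : (e, K) ∉ E₂ := by
  intro hK
  obtain ⟨p, -, hp⟩ := hcross _ hJ _ hK
  have hpm : p ∈ D.trace (e, J) ∩ D.trace (e, K) := by rw [hp]; rfl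
  obtain ⟨⟨u, hu, rfl⟩, ⟨u', hu', huu⟩⟩ := hpm
  -- Since the edge does not meet itself, the common point has a single parameter; the two
  -- components both contain it and therefore coincide.
  have huu' : u' = u := hD.1 e huu
  subst huu'
  have hJ' : (e, J) ∈ D.pieces R := by rw [hR]; exact Or.inl hJ
  have hK' : (e, K) ∈ D.pieces R := by rw [hR]; exact Or.inr hK
  obtain ⟨t, ht, hJt⟩ := hJ'
  obtain ⟨t', ht', hKt⟩ := hK'
  simp only at hJt hKt hu hu'
  have : J = K := by
    rw [hJt] at hu
    rw [hKt] at hu'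
    rw [hJt, hKt, connectedComponentIn_eq hu, connectedComponentIn_eq hu']
  subst this
  exact disjoint_left.1 hE hJ hK

/-- If the crossings of a simple drawing form one bundled crossing, then the edges can be coloured
with two colours so that crossing edges have different colours. -/
theorem IsSimple.bipartite_of_isBundledCrossing {D : GraphDrawing G} (hD : D.IsSimple)
    (hB : D.IsBundledCrossing D.crossings) : ∃ col : G.edgeSet → Prop,
      ∀ e f s t, e ≠ f → D.curve e s = D.curve f t → D.curve e s ∈ D.crossings →
        (col e ↔ ¬ col f) := by
  obtain ⟨R, E₁, E₂, hBR, hR, hE, -, hcross, hd1, hd2, -⟩ := hB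
  -- The colour of an edge records whether it has a piece in `E₁`. At a crossing, the pieces of the
  -- two edges share a point, so they cannot lie in the same bundle.
  refine ⟨fun e => ∃ J, (e, J) ∈ E₁, fun e f s t hef hst hmem => ?_⟩
  have hpR : D.curve e s ∈ R := by
    rw [hBR] at hmem
    exact hmem.2
  have hs : s ∈ D.curve e ⁻¹' R := hpR
  have ht : t ∈ D.curve f ⁻¹' R := by rw [mem_preimage, ← hst]; exact hpR
  set J := connectedComponentIn (D.curve e ⁻¹' R) s
  set K := connectedComponentIn (D.curve f ⁻¹' R) t
  have hJ : (e, J) ∈ E₁ ∪ E₂ := by rw [← hR]; exact ⟨s, hs, rfl⟩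
  have hK : (f, K) ∈ E₁ ∪ E₂ := by rw [← hR]; exact ⟨t, ht, rfl⟩
  have hpJ : D.curve e s ∈ D.trace (e, J) := ⟨s, mem_connectedComponentIn hs, rfl⟩
  have hpK : D.curve e s ∈ D.trace (f, K) := ⟨t, mem_connectedComponentIn ht, hst.symm⟩
  have hJK : (e, J) ≠ (f, K) := fun h => hef (congrArg Prod.fst h)
  rcases hJ with hJ | hJ <;> rcases hK with hK | hK
  · exact absurd hpK (disjoint_left.1 (hd1 hJ hK hJK) hpJ)
  · exact iff_of_true ⟨_, hJ⟩
      fun ⟨L, hL⟩ => hD.not_mem_of_mem_bundle hR hE hcross hL hK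
  · refine iff_of_false (fun ⟨L, hL⟩ => hD.not_mem_of_mem_bundle hR hE hcross hL hJ) ?_
    exact not_not_intro ⟨_, hK⟩
  · exact absurd hpK (disjoint_left.1 (hd2 hJ hK hJK) hpJ)

theorem card_ne_one_of_isBundling {D : GraphDrawing (completeBipartiteGraph (Fin 3) (Fin 3))}
    (hS : D.IsSimple) (hD : D.IsCircular) {P : Finset (Set ℂ)} (hP : D.IsBundling P) :
    P.card ≠ 1 := by
  intro h
  obtain ⟨B, rfl⟩ := Finset.card_eq_one.1 h
  have hB : B = D.crossings := by simpa using hP.2.2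
  obtain ⟨col, hcol⟩ := hS.bipartite_of_isBundledCrossing
    (hB ▸ (hP.1 B (Finset.mem_singleton_self B)).2)
  exact not_bipartite_crossings hD col hcol

end GraphDrawing

/-! ### Every simple drawing of a finite graph has a bundling -/

namespace GraphDrawing

variable {V : Type*} {G : SimpleGraph V}

theorem finite_crossings [Finite G.edgeSet] (D : GraphDrawing G) : D.crossings.Finite := by
  refine (finite_iUnion fun e : G.edgeSet => finite_iUnion fun f : G.edgeSet =>
    (D.finite_common e f).image fun x => D.curve e x.1).subset ?_
  rintro p ⟨-, x, y, hxy, rfl, hy⟩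
  exact mem_iUnion.2 ⟨x.1, mem_iUnion.2 ⟨y.1, (x.2, y.2), ⟨hxy, hy.symm⟩, rfl⟩⟩

/-- Every crossing of a simple drawing is a bundled crossing. -/
theorem IsSimple.isBundledCrossing_singleton {D : GraphDrawing G} (hD : D.IsSimple) {p : ℂ}
    (hp : p ∈ D.crossings) : D.IsBundledCrossing {p} := by
  obtain ⟨hpos, ⟨e, s⟩, ⟨f, t⟩, hne, hs, ht⟩ := id hp
  simp only at hs ht
  have hpre : ∀ g u, D.curve g u = p → connectedComponentIn (D.curve g ⁻¹' {p}) u = {u} := by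
    intro g u hu
    have : D.curve g ⁻¹' {p} = {u} := by
      ext v
      simp only [mem_preimage, mem_singleton_iff]
      exact ⟨fun h => hD.1 g (h.trans hu.symm), fun h => h ▸ hu⟩
    rw [this]
    exact (connectedComponentIn_subset _ _).antisymm
      (singleton_subset_iff.2 (mem_connectedComponentIn rfl))
  have htwo : ∀ g u, D.curve g u = p → (g, u) = (e, s) ∨ (g, u) = (f, t) := by
    intro g u hu
    by_contra! hc
    have h3 : ({(g, u), (e, s), (f, t)} : Set (G.edgeSet × I)).encard = 3 :=
      encard_eq_three.2 ⟨_, _, _, hc.1, hc.2, hne, rfl⟩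
    have hsub : ({(g, u), (e, s), (f, t)} : Set (G.edgeSet × I)) ⊆
        {x | D.curve x.1 x.2 = p} := by
      rintro x (rfl | rfl | rfl) <;> assumption
    have := (encard_le_encard hsub).trans (D.at_most_two p hpos)
    rw [h3] at this
    exact absurd this (by decide)
  have hef : e ≠ f := by
    rintro rfl
    exact hne (congrArg _ (hD.1 e (hs.trans ht.symm)))
  have htre : D.trace (e, {s}) = {p} := by simp [trace, hs]
  have htrf : D.trace (f, {t}) = {p} := by simp [trace, ht]
  -- The degenerate frame: the region is the point `p`, and each of the two strands through it
  -- contributes a piece with a single parameter.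
  refine ⟨{p}, {(e, {s})}, {(f, {t})}, ?_, ?_, ?_, ?_, ?_, pairwiseDisjoint_singleton _ _,
    pairwiseDisjoint_singleton _ _, _, rfl, _, rfl, _, rfl, _, rfl,
    Or.inr ⟨rfl, htre.symm, s, s, le_rfl, (Icc_self s).symm, ?_, ?_⟩⟩
  · exact (inter_eq_right.2 (singleton_subset_iff.2 hp)).symm
  · ext ⟨g, J⟩
    constructor
    · rintro ⟨u, hu, hJ⟩
      simp only at hu hJ
      rw [hpre g u hu] at hJ
      subst hJ
      rcases htwo g u hu with h | h
      · obtain ⟨rfl, rfl⟩ := Prod.mk.inj h; exact Or.inl rfl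
      · obtain ⟨rfl, rfl⟩ := Prod.mk.inj h; exact Or.inr rfl
    · rintro (h | h)
      · obtain ⟨rfl, rfl⟩ := Prod.mk.inj h; exact ⟨s, hs, (hpre _ _ hs).symm⟩
      · obtain ⟨rfl, rfl⟩ := Prod.mk.inj h; exact ⟨t, ht, (hpre _ _ ht).symm⟩
  · exact disjoint_singleton.2 fun h => hef (congrArg Prod.fst h)
  · exact fun a _ => (hD.1 a.1).injOn
  · rintro _ rfl _ rfl
    exact ⟨p, hp, by rw [htre, htrf, inter_self]⟩
  · rw [htrf]; exact hs
  · rw [htrf]; exact hs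

/-- Each crossing forms a class of its own. -/
theorem IsSimple.exists_isBundling [Finite G.edgeSet] {D : GraphDrawing G} (hD : D.IsSimple) :
    ∃ P, D.IsBundling P := by
  classical
  refine ⟨D.finite_crossings.toFinset.image singleton, ?_, ?_, ?_⟩
  · intro B hB
    obtain ⟨p, hp, rfl⟩ := Finset.mem_image.1 hB
    exact ⟨singleton_nonempty p,
      hD.isBundledCrossing_singleton ((Finite.mem_toFinset _).1 hp)⟩
  · intro B hB B' hB' hne
    obtain ⟨p, -, rfl⟩ := Finset.mem_image.1 (Finset.mem_coe.1 hB)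
    obtain ⟨q, -, rfl⟩ := Finset.mem_image.1 (Finset.mem_coe.1 hB')
    exact disjoint_singleton.2 fun h => hne (by rw [h])
  · ext p
    simp

end GraphDrawing

/-! ### Transversality of straight curves -/

section CurvesCrossAt

/-- Composing the chart with multiplication by `I` interchanges the real and the imaginary axis. -/
theorem CurvesCrossAt.symm {c c' : C(I, ℂ)} {s t : I} (h : CurvesCrossAt c c' s t) :
    CurvesCrossAt c' c t s := by
  obtain ⟨heq, φ, hs, h0, h1, h2⟩ := h
  refine ⟨heq.symm, φ.transHomeomorph (Homeomorph.mulLeft₀ Complex.I Complex.I_ne_zero),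
    ?_, ?_, ?_, ?_⟩
  · simpa [← heq] using hs
  · simp [← heq, h0]
  · filter_upwards [h2] with v hv
    simp [hv]
  · filter_upwards [h1] with v hv
    simp [hv]

/-- Two curves that are locally straight, with independent directions, cross. -/
theorem curvesCrossAt_of_affine {c c' : C(I, ℂ)} {s t : I} {v w : ℂ} (h : c s = c' t)
    (hc : ∀ᶠ u in 𝓝 s, c u = c s + ((u : ℝ) - s) • v)
    (hc' : ∀ᶠ u in 𝓝 t, c' u = c' t + ((u : ℝ) - t) • w)
    (hvw : v.re * w.im - v.im * w.re ≠ 0) : CurvesCrossAt c c' s t := by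
  set d := v.re * w.im - v.im * w.re with hd
  -- Coordinates with respect to the basis `v`, `w` and the origin `c s`, computed by Cramer's rule.
  let φ : ℂ ≃ₜ ℂ :=
    { toFun := fun z => ⟨((z - c s).re * w.im - (z - c s).im * w.re) / d,
        (v.re * (z - c s).im - v.im * (z - c s).re) / d⟩
      invFun := fun ζ => c s + ζ.re • v + ζ.im • w
      left_inv := fun z => by
        apply Complex.ext <;> simp <;> field_simp <;> rw [hd] <;> ring
      right_inv := fun z => by
        apply Complex.ext <;> simp <;> field_simp <;> rw [hd] <;> ring
      continuous_toFun := by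
        refine Complex.equivRealProdCLM.symm.continuous.comp
          (f := fun z : ℂ => (((z - c s).re * w.im - (z - c s).im * w.re) / d,
            (v.re * (z - c s).im - v.im * (z - c s).re) / d)) ?_
        fun_prop
      continuous_invFun := by fun_prop }
  refine ⟨h, φ.toOpenPartialHomeomorph, mem_univ _, ?_, ?_, ?_⟩
  · apply Complex.ext <;> simp [φ]
  · filter_upwards [hc] with u hu
    rw [hu]
    simp [φ]
    left; ring
  · filter_upwards [hc'] with u hu
    rw [hu, ← h]
    simp [φ]
    left; ring

/-- The straight curve from `a` to `b`. -/
noncomputable def lineCurve (a b : ℂ) : C(I, ℂ) where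
  toFun t := a + (t : ℝ) • (b - a)
  continuous_toFun := by fun_prop

theorem lineCurve_apply (a b : ℂ) (t : I) : lineCurve a b t = a + (t : ℝ) • (b - a) := rfl

@[simp] theorem lineCurve_zero (a b : ℂ) : lineCurve a b 0 = a := by simp [lineCurve_apply]

@[simp] theorem lineCurve_one (a b : ℂ) : lineCurve a b 1 = b := by simp [lineCurve_apply]

theorem lineCurve_injective {a b : ℂ} (h : a ≠ b) : Function.Injective (lineCurve a b) := by
  intro s t hst
  rw [lineCurve_apply, lineCurve_apply, add_right_inj] at hst
  exact Subtype.ext (smul_left_injective ℝ (sub_ne_zero.2 h.symm) hst)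

theorem lineCurve_affine (a b : ℂ) (s u : I) :
    lineCurve a b u = lineCurve a b s + ((u : ℝ) - s) • (b - a) := by
  rw [lineCurve_apply, lineCurve_apply, sub_smul]; abel

theorem lineCurve_mem_ball {a b : ℂ} (ha : ‖a‖ = 1) (hb : ‖b‖ = 1) (hab : a ≠ b) {t : I}
    (h0 : t ≠ 0) (h1 : t ≠ 1) : lineCurve a b t ∈ Metric.ball (0 : ℂ) 1 := by
  apply openSegment_subset_ball_of_ne (by simp [ha]) (by simp [hb]) hab
  rw [openSegment_eq_image']
  exact ⟨t, ⟨unitInterval.pos_iff_ne_zero.2 h0, unitInterval.lt_one_iff_ne_one.2 h1⟩, rfl⟩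

end CurvesCrossAt

/-! ### Drawings of `K₃,₃` made of a hexagon and three curves for its long diagonals -/

section Hexagon

/-- The edges of `K₃,₃` are the pairs of vertices from different sides. -/
noncomputable def completeBipartiteEdgeEquiv :
    Fin 3 × Fin 3 ≃ (completeBipartiteGraph (Fin 3) (Fin 3)).edgeSet :=
  Equiv.ofBijective (fun x => ⟨s(Sum.inl x.1, Sum.inr x.2), by simp⟩) <| by
    constructor
    · rintro ⟨i, j⟩ ⟨k, l⟩ h
      simpa using h
    · rintro ⟨e, he⟩
      induction e with
      | _ x y =>
        rcases x with x | x <;> rcases y with y | y <;> simp at he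
        · exact ⟨(x, y), rfl⟩
        · exact ⟨(y, x), Subtype.ext Sym2.eq_swap⟩

theorem coe_completeBipartiteEdgeEquiv (x : Fin 3 × Fin 3) :
    (completeBipartiteEdgeEquiv x : Sym2 (Fin 3 ⊕ Fin 3)) = s(Sum.inl x.1, Sum.inr x.2) := rfl

/-- The corners of a convex hexagon inscribed in the unit circle, in which the two sides of `K₃,₃`
alternate and the vertices `Sum.inl i` and `Sum.inr i` are opposite. -/
noncomputable def hexagonPos : Fin 3 ⊕ Fin 3 → ℂ :=
  Sum.elim ![⟨-24 / 25, 7 / 25⟩, ⟨7 / 25, 24 / 25⟩, ⟨-7 / 25, -24 / 25⟩]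
    ![⟨24 / 25, 7 / 25⟩, ⟨-24 / 25, -7 / 25⟩, ⟨-7 / 25, 24 / 25⟩]

theorem norm_hexagonPos (v : Fin 3 ⊕ Fin 3) : ‖hexagonPos v‖ = 1 := by
  rw [← sq_eq_sq₀ (norm_nonneg _) zero_le_one, Complex.sq_norm, Complex.normSq_apply]
  rcases v with i | i <;> fin_cases i <;> norm_num [hexagonPos]

theorem hexagonPos_injective : Function.Injective hexagonPos := by
  intro v w h
  rw [Complex.ext_iff] at h
  rcases v with i | i <;> rcases w with j | j <;> fin_cases i <;> fin_cases j <;>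
    first | rfl | (exfalso; norm_num [hexagonPos] at h)

/-- For `i ≠ j`, an affine function that vanishes on the side of the hexagon from `Sum.inl i` to
`Sum.inr j` and is positive on the rest of the hexagon. -/
noncomputable def hexagonSlack (i j : Fin 3) (z : ℂ) : ℝ :=
  (![![0, 1, 1], ![-1, 0, 0], ![-1, 1, 0]] : Fin 3 → Fin 3 → ℝ) i j * z.re +
    (![![0, 0, -1], ![-1, 0, -1], ![1, 1, 0]] : Fin 3 → Fin 3 → ℝ) i j * z.im +
    (![![0, 24 / 25, 31 / 25], ![31 / 25, 0, 24 / 25], ![17 / 25, 31 / 25, 0]] :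
      Fin 3 → Fin 3 → ℝ) i j

theorem hexagonSlack_lineCurve (i j : Fin 3) (a b : ℂ) (t : I) :
    hexagonSlack i j (lineCurve a b t) =
      (1 - t) * hexagonSlack i j a + t * hexagonSlack i j b := by
  simp [hexagonSlack, lineCurve_apply]; ring

theorem hexagonSlack_inl {i j : Fin 3} (h : i ≠ j) (k : Fin 3) :
    (k = i → hexagonSlack i j (hexagonPos (Sum.inl k)) = 0) ∧
      (k ≠ i → 0 < hexagonSlack i j (hexagonPos (Sum.inl k))) := by
  fin_cases i <;> fin_cases j <;> fin_cases k <;> simp [Fin.reduceFinMk] at h ⊢ <;>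
    simp [hexagonSlack, hexagonPos] <;> norm_num

theorem hexagonSlack_inr {i j : Fin 3} (h : i ≠ j) (k : Fin 3) :
    (k = j → hexagonSlack i j (hexagonPos (Sum.inr k)) = 0) ∧
      (k ≠ j → 0 < hexagonSlack i j (hexagonPos (Sum.inr k))) := by
  fin_cases i <;> fin_cases j <;> fin_cases k <;> simp [Fin.reduceFinMk] at h ⊢ <;>
    simp [hexagonSlack, hexagonPos] <;> norm_num

/-- The straight curve between two corners of the hexagon on different sides of `K₃,₃`. -/
noncomputable def hexagonLine (i j : Fin 3) : C(I, ℂ) :=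
  lineCurve (hexagonPos (Sum.inl i)) (hexagonPos (Sum.inr j))

theorem hexagonLine_injective (i j : Fin 3) : Function.Injective (hexagonLine i j) :=
  lineCurve_injective (hexagonPos_injective.ne (by simp))

theorem hexagonLine_mem_ball (i j : Fin 3) {t : I} (h0 : t ≠ 0) (h1 : t ≠ 1) :
    hexagonLine i j t ∈ Metric.ball (0 : ℂ) 1 :=
  lineCurve_mem_ball (norm_hexagonPos _) (norm_hexagonPos _) (hexagonPos_injective.ne (by simp))
    h0 h1

theorem hexagonSlack_hexagonLine_self {i j : Fin 3} (h : i ≠ j) (t : I) :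
    hexagonSlack i j (hexagonLine i j t) = 0 := by
  rw [hexagonLine, hexagonSlack_lineCurve, (hexagonSlack_inl h i).1 rfl,
    (hexagonSlack_inr h j).1 rfl]
  simp

/-- The slack is affine along the segment, nonnegative at both ends, and zero at both only for the
side itself. -/
theorem hexagonSlack_hexagonLine_pos {i j k l : Fin 3} (h : i ≠ j) (hne : (k, l) ≠ (i, j))
    {t : I} (h0 : t ≠ 0) (h1 : t ≠ 1) : 0 < hexagonSlack i j (hexagonLine k l t) := by
  have t0 : 0 < (t : ℝ) := unitInterval.pos_iff_ne_zero.2 h0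
  have t1 : 0 < 1 - (t : ℝ) := sub_pos.2 (unitInterval.lt_one_iff_ne_one.2 h1)
  rw [hexagonLine, hexagonSlack_lineCurve]
  by_cases hk : k = i
  · have hl : l ≠ j := fun hl => hne (by rw [hk, hl])
    rw [(hexagonSlack_inl h k).1 hk]
    have := mul_pos t0 ((hexagonSlack_inr h l).2 hl)
    linarith
  · have a := mul_pos t1 ((hexagonSlack_inl h k).2 hk)
    by_cases hl : l = j
    · rw [(hexagonSlack_inr h l).1 hl]; linarith
    · have := mul_pos t0 ((hexagonSlack_inr h l).2 hl)
      linarith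

/-- Curves for the three long diagonals of the hexagon, with a list of their pairwise and
self-crossings. -/
structure HexagonDiagonals where
  /-- the curve from `Sum.inl i` to `Sum.inr i` -/
  diag : Fin 3 → C(I, ℂ)
  diag_zero : ∀ i, diag i 0 = hexagonPos (Sum.inl i)
  diag_one : ∀ i, diag i 1 = hexagonPos (Sum.inr i)
  diag_mem_ball : ∀ i t, t ≠ 0 → t ≠ 1 → diag i t ∈ Metric.ball (0 : ℂ) 1
  slack_pos : ∀ i t, t ≠ 0 → t ≠ 1 → ∀ k l, k ≠ l → 0 < hexagonSlack k l (diag i t)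
  /-- the number of crossings -/
  n : ℕ
  /-- the first strand at a crossing -/
  fst : Fin n → Fin 3 × I
  /-- the second strand at a crossing -/
  snd : Fin n → Fin 3 × I
  fst_ne : ∀ k, (fst k).2 ≠ 0 ∧ (fst k).2 ≠ 1
  strands_injective : Function.Injective (Sum.elim fst snd)
  crossAt : ∀ k, CurvesCrossAt (diag (fst k).1) (diag (snd k).1) (fst k).2 (snd k).2
  eq_fst_snd : ∀ x y : Fin 3 × I, x ≠ y → diag x.1 x.2 = diag y.1 y.2 → x.2 ≠ 0 → x.2 ≠ 1 →
    y.2 ≠ 0 → y.2 ≠ 1 → ∃ k, (x = fst k ∧ y = snd k) ∨ (x = snd k ∧ y = fst k)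

namespace HexagonDiagonals

variable (H : HexagonDiagonals)

/-- The curves of the edges: the given curves and the sides of the hexagon. -/
noncomputable def edgeCurve (x : Fin 3 × Fin 3) : C(I, ℂ) :=
  if x.1 = x.2 then H.diag x.1 else hexagonLine x.1 x.2

theorem edgeCurve_diag (i : Fin 3) : H.edgeCurve (i, i) = H.diag i := if_pos rfl

theorem edgeCurve_of_ne {x : Fin 3 × Fin 3} (h : x.1 ≠ x.2) :
    H.edgeCurve x = hexagonLine x.1 x.2 := if_neg h

theorem edgeCurve_zero (x : Fin 3 × Fin 3) : H.edgeCurve x 0 = hexagonPos (Sum.inl x.1) := by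
  by_cases h : x.1 = x.2
  · rw [edgeCurve, if_pos h, H.diag_zero]
  · rw [H.edgeCurve_of_ne h, hexagonLine, lineCurve_zero]

theorem edgeCurve_one (x : Fin 3 × Fin 3) : H.edgeCurve x 1 = hexagonPos (Sum.inr x.2) := by
  by_cases h : x.1 = x.2
  · rw [edgeCurve, if_pos h, H.diag_one, h]
  · rw [H.edgeCurve_of_ne h, hexagonLine, lineCurve_one]

theorem edgeCurve_mem_ball (x : Fin 3 × Fin 3) {t : I} (h0 : t ≠ 0) (h1 : t ≠ 1) :
    H.edgeCurve x t ∈ Metric.ball (0 : ℂ) 1 := by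
  by_cases h : x.1 = x.2
  · rw [edgeCurve, if_pos h]; exact H.diag_mem_ball _ _ h0 h1
  · rw [H.edgeCurve_of_ne h]; exact hexagonLine_mem_ball _ _ h0 h1

theorem edgeCurve_not_mem_range_iff (x : Fin 3 × Fin 3) (t : I) :
    H.edgeCurve x t ∉ range hexagonPos ↔ t ≠ 0 ∧ t ≠ 1 := by
  constructor
  · intro h
    constructor
    · rintro rfl; exact h ⟨_, (H.edgeCurve_zero x).symm⟩
    · rintro rfl; exact h ⟨_, (H.edgeCurve_one x).symm⟩
  · rintro ⟨h0, h1⟩ ⟨v, hv⟩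
    have := H.edgeCurve_mem_ball x h0 h1
    rw [← hv, mem_ball_zero_iff, norm_hexagonPos] at this
    exact lt_irrefl _ this

/-- A side of the hexagon does not meet any other edge except at the ends. -/
theorem eq_of_edgeCurve_eq {x y : Fin 3 × Fin 3} (hx : x.1 ≠ x.2) {s t : I}
    (h : H.edgeCurve x s = H.edgeCurve y t) (t0 : t ≠ 0) (t1 : t ≠ 1) : (x, s) = (y, t) := by
  have h0 : hexagonSlack x.1 x.2 (H.edgeCurve y t) = 0 := by
    rw [← h, H.edgeCurve_of_ne hx, hexagonSlack_hexagonLine_self hx]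
  have hyx : y = x := by
    by_contra hyx
    refine h0.not_gt ?_
    by_cases hy : y.1 = y.2
    · rw [edgeCurve, if_pos hy]; exact H.slack_pos _ _ t0 t1 _ _ hx
    · rw [H.edgeCurve_of_ne hy]; exact hexagonSlack_hexagonLine_pos hx hyx t0 t1
  subst hyx
  rw [H.edgeCurve_of_ne hx] at h
  rw [hexagonLine_injective _ _ h]

/-- The strand of an edge given by a strand of a long diagonal. -/
def strand (a : Fin 3 × I) : (Fin 3 × Fin 3) × I := ((a.1, a.1), a.2)

theorem strand_injective : Function.Injective strand := fun a b h => by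
  obtain ⟨h1, h2⟩ := Prod.mk.inj h
  exact Prod.ext (Prod.mk.inj h1).1 h2

/-- Sides of the hexagon are excluded by `eq_of_edgeCurve_eq`, so both strands belong to long
diagonals, where the list of crossings is complete. -/
theorem exists_crossing {x y : (Fin 3 × Fin 3) × I} (hxy : x ≠ y)
    (h : H.edgeCurve x.1 x.2 = H.edgeCurve y.1 y.2)
    (hp : H.edgeCurve x.1 x.2 ∉ range hexagonPos) :
    ∃ k, (x = strand (H.fst k) ∧ y = strand (H.snd k)) ∨
      (x = strand (H.snd k) ∧ y = strand (H.fst k)) := by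
  obtain ⟨⟨i, i'⟩, s⟩ := x
  obtain ⟨⟨j, j'⟩, t⟩ := y
  obtain ⟨s0, s1⟩ := (H.edgeCurve_not_mem_range_iff _ _).1 hp
  rw [h] at hp
  obtain ⟨t0, t1⟩ := (H.edgeCurve_not_mem_range_iff _ _).1 hp
  simp only at h s0 s1 t0 t1
  by_cases hi : i = i'
  swap
  · exact absurd (H.eq_of_edgeCurve_eq hi h t0 t1) hxy
  by_cases hj : j = j'
  swap
  · exact absurd (H.eq_of_edgeCurve_eq hj h.symm s0 s1).symm hxy
  subst hi hj
  rw [H.edgeCurve_diag, H.edgeCurve_diag] at h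
  obtain ⟨k, hk⟩ := H.eq_fst_snd (i, s) (j, t)
    (fun hne => hxy (congrArg strand hne)) h s0 s1 t0 t1
  refine ⟨k, ?_⟩
  rcases hk with ⟨h1, h2⟩ | ⟨h1, h2⟩
  · left; rw [← h1, ← h2]; exact ⟨rfl, rfl⟩
  · right; rw [← h1, ← h2]; exact ⟨rfl, rfl⟩

/-- By `strands_injective` a strand occurs only once in the list of crossings, so it determines its
partner. This excludes triple points. -/
theorem eq_of_edgeCurve_eq_of_eq {x y z : (Fin 3 × Fin 3) × I} (hxy : x ≠ y) (hxz : x ≠ z)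
    (h : H.edgeCurve x.1 x.2 = H.edgeCurve y.1 y.2)
    (h' : H.edgeCurve x.1 x.2 = H.edgeCurve z.1 z.2)
    (hp : H.edgeCurve x.1 x.2 ∉ range hexagonPos) : y = z := by
  have inj : ∀ a b : Fin H.n ⊕ Fin H.n, strand (Sum.elim H.fst H.snd a) =
      strand (Sum.elim H.fst H.snd b) → a = b :=
    fun a b h => H.strands_injective (strand_injective h)
  obtain ⟨k, hk⟩ := H.exists_crossing hxy h hp
  obtain ⟨l, hl⟩ := H.exists_crossing hxz h' hp
  rcases hk with ⟨h1, h2⟩ | ⟨h1, h2⟩ <;> rcases hl with ⟨h3, h4⟩ | ⟨h3, h4⟩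
  · obtain rfl := Sum.inl_injective (inj (Sum.inl k) (Sum.inl l) (h1.symm.trans h3))
    rw [h2, h4]
  · exact absurd (inj (Sum.inl k) (Sum.inr l) (h1.symm.trans h3)) (by simp)
  · exact absurd (inj (Sum.inr k) (Sum.inl l) (h1.symm.trans h3)) (by simp)
  · obtain rfl := Sum.inr_injective (inj (Sum.inr k) (Sum.inr l) (h1.symm.trans h3))
    rw [h2, h4]

theorem edgeCurve_strand (a : Fin 3 × I) :
    H.edgeCurve (strand a).1 (strand a).2 = H.diag a.1 a.2 := by
  simp only [strand, edgeCurve_diag]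

theorem edgeCurve_crossAt (k : Fin H.n) :
    CurvesCrossAt (H.edgeCurve (strand (H.fst k)).1) (H.edgeCurve (strand (H.snd k)).1)
      (strand (H.fst k)).2 (strand (H.snd k)).2 := by
  simp only [strand, edgeCurve_diag]
  exact H.crossAt k

/-- The drawing of `K₃,₃` given by the sides of the hexagon and curves for the long diagonals. -/
noncomputable def drawing : GraphDrawing (completeBipartiteGraph (Fin 3) (Fin 3)) where
  pos := hexagonPos
  pos_injective := hexagonPos_injective
  curve e := H.edgeCurve (completeBipartiteEdgeEquiv.symm e)
  curve_ends e := by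
    obtain ⟨x, rfl⟩ := completeBipartiteEdgeEquiv.surjective e
    rw [Equiv.symm_apply_apply, edgeCurve_zero, edgeCurve_one, coe_completeBipartiteEdgeEquiv,
      Sym2.map_mk]
  curve_interior e t h0 h1 := (H.edgeCurve_not_mem_range_iff _ _).2 ⟨h0, h1⟩
  finite_common e f := by
    obtain ⟨x, rfl⟩ := completeBipartiteEdgeEquiv.surjective e
    obtain ⟨y, rfl⟩ := completeBipartiteEdgeEquiv.surjective f
    simp only [Equiv.symm_apply_apply]
    -- Coincidences happen at ends of both edges or at a listed crossing, whose strands may appear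
    -- in either order.
    have hfin : (({0, 1} ×ˢ {0, 1} : Set (I × I)) ∪
        (range (fun k => ((H.fst k).2, (H.snd k).2)) ∪
          range (fun k => ((H.snd k).2, (H.fst k).2)))).Finite :=
      ((toFinite _).prod (toFinite _)).union ((finite_range _).union (finite_range _))
    refine hfin.subset ?_
    rintro ⟨s, t⟩ ⟨hne, heq⟩
    simp only at hne heq
    by_cases hp : H.edgeCurve x s ∈ range hexagonPos
    · left
      have hs := mt (H.edgeCurve_not_mem_range_iff x s).2 (not_not_intro hp)
      rw [heq] at hp
      have ht := mt (H.edgeCurve_not_mem_range_iff y t).2 (not_not_intro hp)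
      refine ⟨?_, ?_⟩ <;> simp only [mem_insert_iff, mem_singleton_iff] <;> tauto
    · right
      obtain ⟨k, ⟨h1, h2⟩ | ⟨h1, h2⟩⟩ := H.exists_crossing (x := (x, s)) (y := (y, t))
        (fun h => hne (by obtain ⟨rfl, rfl⟩ := Prod.mk.inj h; rfl)) heq hp
      · exact Or.inl ⟨k, Prod.ext (congrArg Prod.snd h1).symm (congrArg Prod.snd h2).symm⟩
      · exact Or.inr ⟨k, Prod.ext (congrArg Prod.snd h1).symm (congrArg Prod.snd h2).symm⟩
  at_most_two p hp := by
    by_contra hc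
    rw [not_le] at hc
    obtain ⟨T, hT, hT3⟩ := exists_subset_encard_eq (Order.add_one_le_of_lt hc)
    obtain ⟨x, y, z, hxy, hxz, hyz, rfl⟩ := encard_eq_three.1 (hT3.trans two_add_one_eq_three)
    have hx := hT (mem_insert x _)
    have hy := hT (mem_insert_of_mem x (mem_insert y _))
    have hz := hT (mem_insert_of_mem x (mem_insert_of_mem y (mem_singleton z)))
    obtain ⟨⟨e, s⟩, rfl⟩ :=
      (completeBipartiteEdgeEquiv.prodCongr (Equiv.refl I)).surjective x
    obtain ⟨⟨f, t⟩, rfl⟩ :=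
      (completeBipartiteEdgeEquiv.prodCongr (Equiv.refl I)).surjective y
    obtain ⟨⟨g, u⟩, rfl⟩ :=
      (completeBipartiteEdgeEquiv.prodCongr (Equiv.refl I)).surjective z
    simp only [mem_ofPred_eq, Equiv.prodCongr_apply, Prod.map_apply, Equiv.symm_apply_apply,
      Equiv.refl_apply] at hx hy hz
    subst hx
    refine hyz (congrArg _ (H.eq_of_edgeCurve_eq_of_eq (x := (e, s)) ?_ ?_ hy.symm hz.symm hp))
    · exact fun h => hxy (congrArg _ h)
    · exact fun h => hxz (congrArg _ h)
  transversal e f s t hne heq hp := by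
    obtain ⟨k, ⟨h1, h2⟩ | ⟨h1, h2⟩⟩ := H.exists_crossing
      (x := (completeBipartiteEdgeEquiv.symm e, s)) (y := (completeBipartiteEdgeEquiv.symm f, t))
      (fun h => hne (by
        obtain ⟨h1, rfl⟩ := Prod.mk.inj h
        rw [completeBipartiteEdgeEquiv.symm.injective h1])) heq hp
    · have := H.edgeCurve_crossAt k
      rwa [← h1, ← h2] at this
    · have := (H.edgeCurve_crossAt k).symm
      rwa [← h1, ← h2] at this

theorem drawing_curve (x : Fin 3 × Fin 3) :
    H.drawing.curve (completeBipartiteEdgeEquiv x) = H.edgeCurve x := by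
  simp [drawing]

theorem isCircular_drawing : H.drawing.IsCircular :=
  ⟨fun v => mem_sphere_zero_iff_norm.2 (norm_hexagonPos v),
    fun _ _ h0 h1 => H.edgeCurve_mem_ball _ h0 h1⟩

theorem mem_crossings_iff {p : ℂ} :
    p ∈ H.drawing.crossings ↔ ∃ k, p = H.diag (H.fst k).1 (H.fst k).2 := by
  constructor
  · rintro ⟨hp, ⟨e, s⟩, ⟨f, t⟩, hne, rfl, heq⟩
    obtain ⟨k, ⟨h1, -⟩ | ⟨h1, -⟩⟩ := H.exists_crossing
      (x := (completeBipartiteEdgeEquiv.symm e, s)) (y := (completeBipartiteEdgeEquiv.symm f, t))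
      (fun h => hne (by
        obtain ⟨h1, rfl⟩ := Prod.mk.inj h
        rw [completeBipartiteEdgeEquiv.symm.injective h1])) heq.symm hp
    · refine ⟨k, ?_⟩
      rw [← H.edgeCurve_strand, ← h1]
      rfl
    · refine ⟨k, ?_⟩
      rw [(H.crossAt k).1, ← H.edgeCurve_strand, ← h1]
      rfl
  · rintro ⟨k, rfl⟩
    refine ⟨?_, (completeBipartiteEdgeEquiv (strand (H.fst k)).1, (H.fst k).2),
      (completeBipartiteEdgeEquiv (strand (H.snd k)).1, (H.snd k).2), ?_, ?_, ?_⟩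
    · rw [← H.edgeCurve_strand]
      exact (H.edgeCurve_not_mem_range_iff _ _).2 (H.fst_ne k)
    · intro h
      obtain ⟨h1, h2⟩ := Prod.mk.inj h
      have h3 : H.fst k = H.snd k :=
        Prod.ext (Prod.mk.inj (completeBipartiteEdgeEquiv.injective h1)).1 h2
      exact absurd (H.strands_injective (a₁ := Sum.inl k) (a₂ := Sum.inr k) h3) (by simp)
    · simp only [drawing_curve]
      exact H.edgeCurve_strand _
    · simp only [drawing_curve]
      rw [(H.crossAt k).1]
      exact H.edgeCurve_strand _

end HexagonDiagonals

end Hexagon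

/-! ### The simple drawing with straight diagonals -/

section StraightHexagon

theorem hexagonLine_zero_zero (t : I) :
    hexagonLine 0 0 t = ⟨(-24 + 48 * t) / 25, 7 / 25⟩ := by
  apply Complex.ext <;> simp [hexagonLine, hexagonPos, lineCurve_apply]
  ring

theorem hexagonLine_one_one (t : I) :
    hexagonLine 1 1 t = ⟨(7 - 31 * t) / 25, (24 - 31 * t) / 25⟩ := by
  apply Complex.ext <;> simp [hexagonLine, hexagonPos, lineCurve_apply] <;> ring

theorem hexagonLine_two_two (t : I) :
    hexagonLine 2 2 t = ⟨-7 / 25, (-24 + 48 * t) / 25⟩ := by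
  apply Complex.ext <;> simp [hexagonLine, hexagonPos, lineCurve_apply]
  ring

theorem hexagonLine_zero (i j : Fin 3) : hexagonLine i j 0 = hexagonPos (Sum.inl i) :=
  lineCurve_zero _ _

theorem hexagonLine_one (i j : Fin 3) : hexagonLine i j 1 = hexagonPos (Sum.inr j) :=
  lineCurve_one _ _

theorem hexagonSlack_hexagonLine_diag_pos (i : Fin 3) (t : I) (h0 : t ≠ 0) (h1 : t ≠ 1)
    (k l : Fin 3) (h : k ≠ l) : 0 < hexagonSlack k l (hexagonLine i i t) :=
  hexagonSlack_hexagonLine_pos h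
    (fun he => h ((Prod.mk.inj he).1.symm.trans (Prod.mk.inj he).2)) h0 h1

theorem unitInterval.mk_ne_zero_and_ne_one {x : ℝ} (hx : x ∈ I) (h0 : x ≠ 0) (h1 : x ≠ 1) :
    (⟨x, hx⟩ : I) ≠ 0 ∧ (⟨x, hx⟩ : I) ≠ 1 :=
  ⟨fun h => h0 (congrArg Subtype.val h), fun h => h1 (congrArg Subtype.val h)⟩

/-- The straight long diagonals of the hexagon. -/
noncomputable def straightDiagonals : HexagonDiagonals where
  diag i := hexagonLine i i
  diag_zero i := hexagonLine_zero i i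
  diag_one i := hexagonLine_one i i
  diag_mem_ball i _ h0 h1 := hexagonLine_mem_ball i i h0 h1
  slack_pos := hexagonSlack_hexagonLine_diag_pos
  n := 3
  -- In units of `1 / 25` the crossings are `(-7, 7)`, `(-10, 7)` and `(-7, 10)`.
  fst := ![(0, ⟨17 / 48, by norm_num, by norm_num⟩), (0, ⟨14 / 48, by norm_num, by norm_num⟩),
    (1, ⟨14 / 31, by norm_num, by norm_num⟩)]
  snd := ![(2, ⟨31 / 48, by norm_num, by norm_num⟩), (1, ⟨17 / 31, by norm_num, by norm_num⟩),
    (2, ⟨34 / 48, by norm_num, by norm_num⟩)]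
  fst_ne k := by
    fin_cases k <;> exact unitInterval.mk_ne_zero_and_ne_one _ (by norm_num) (by norm_num)
  strands_injective := by
    intro a b h
    rcases a with a | a <;> rcases b with b | b <;> fin_cases a <;> fin_cases b <;>
      first | rfl | (exfalso; norm_num [Subtype.ext_iff] at h)
  crossAt k := by
    fin_cases k <;>
      refine curvesCrossAt_of_affine ?_
        (Filter.Eventually.of_forall fun u => lineCurve_affine _ _ _ u)
        (Filter.Eventually.of_forall fun u => lineCurve_affine _ _ _ u) ?_
    · simp only [Fin.reduceFinMk, Matrix.cons_val]
      rw [hexagonLine_zero_zero, hexagonLine_two_two]; norm_num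
    · simp [hexagonPos]; norm_num
    · simp only [Fin.reduceFinMk, Matrix.cons_val]
      rw [hexagonLine_zero_zero, hexagonLine_one_one]; norm_num
    · simp [hexagonPos]; norm_num
    · simp only [Fin.reduceFinMk, Matrix.cons_val]
      rw [hexagonLine_one_one, hexagonLine_two_two]; norm_num
    · simp [hexagonPos]; norm_num
  eq_fst_snd := by
    rintro ⟨i, s⟩ ⟨j, t⟩ hne heq - - - -
    by_cases hij : i = j
    · subst hij
      exact absurd (congrArg (Prod.mk i) (hexagonLine_injective _ _ heq)) hne
    simp only at heq
    fin_cases i <;> fin_cases j <;> simp only [Fin.reduceFinMk] at hij heq ⊢ <;>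
      first | exact absurd trivial hij | skip
    all_goals
      simp only [hexagonLine_zero_zero, hexagonLine_one_one, hexagonLine_two_two,
        Complex.mk.injEq] at heq
      obtain ⟨h1, h2⟩ := heq
    · exact ⟨1, Or.inl ⟨Prod.ext rfl (Subtype.ext (by simp; linarith)),
        Prod.ext rfl (Subtype.ext (by simp; linarith))⟩⟩
    · exact ⟨0, Or.inl ⟨Prod.ext rfl (Subtype.ext (by simp; linarith)),
        Prod.ext rfl (Subtype.ext (by simp; linarith))⟩⟩
    · exact ⟨1, Or.inr ⟨Prod.ext rfl (Subtype.ext (by simp; linarith)),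
        Prod.ext rfl (Subtype.ext (by simp; linarith))⟩⟩
    · exact ⟨2, Or.inl ⟨Prod.ext rfl (Subtype.ext (by simp; linarith)),
        Prod.ext rfl (Subtype.ext (by simp; linarith))⟩⟩
    · exact ⟨0, Or.inr ⟨Prod.ext rfl (Subtype.ext (by simp; linarith)),
        Prod.ext rfl (Subtype.ext (by simp; linarith))⟩⟩
    · exact ⟨2, Or.inr ⟨Prod.ext rfl (Subtype.ext (by simp; linarith)),
        Prod.ext rfl (Subtype.ext (by simp; linarith))⟩⟩

/-- Twice the signed area of the triangle with corners `c`, `d` and `z`. -/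
def signedArea (c d z : ℂ) : ℝ :=
  (z.re - c.re) * (d.im - c.im) - (z.im - c.im) * (d.re - c.re)

theorem signedArea_lineCurve (c d a b : ℂ) (t : I) :
    signedArea c d (lineCurve a b t) = (1 - t) * signedArea c d a + t * signedArea c d b := by
  simp [signedArea, lineCurve_apply]; ring

/-- Two segments that are not on a common line have at most one common point. -/
theorem subsingleton_range_lineCurve_inter {a b c d : ℂ}
    (h : signedArea c d a ≠ 0 ∨ signedArea c d b ≠ 0) :
    (range (lineCurve a b) ∩ range (lineCurve c d)).Subsingleton := by
  have hz : ∀ z ∈ range (lineCurve c d), signedArea c d z = 0 := by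
    rintro _ ⟨t, rfl⟩
    simp [signedArea, lineCurve_apply]; ring
  rintro _ ⟨⟨s, rfl⟩, hs⟩ _ ⟨⟨t, rfl⟩, ht⟩
  have h1 := hz _ hs
  have h2 := hz _ ht
  rw [signedArea_lineCurve] at h1 h2
  by_contra hne
  have hst : (s : ℝ) - t ≠ 0 := sub_ne_zero.2 fun h => hne (by rw [Subtype.ext h])
  -- The signed area is affine along the first segment, so two distinct zeros make it vanish at both
  -- ends.
  have h3 : signedArea c d b - signedArea c d a = 0 :=
    (mul_eq_zero.1 (show ((s : ℝ) - t) * (signedArea c d b - signedArea c d a) = 0 by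
      linear_combination h1 - h2)).resolve_left hst
  have ha : signedArea c d a = 0 := by linear_combination h1 - s * h3
  have hb : signedArea c d b = 0 := by linear_combination h3 + ha
  exact h.elim (fun h => h ha) fun h => h hb

/-- Three distinct points of a circle are not collinear. Different edges differ in an end, and this
end is off the line through the other edge. -/
theorem signedArea_hexagonPos_inl {i k : Fin 3} (h : i ≠ k) (l : Fin 3) :
    signedArea (hexagonPos (Sum.inl k)) (hexagonPos (Sum.inr l)) (hexagonPos (Sum.inl i)) ≠ 0 := by
  fin_cases i <;> fin_cases k <;> fin_cases l <;> simp [Fin.reduceFinMk] at h ⊢ <;>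
    simp [hexagonPos, signedArea] <;> norm_num

theorem signedArea_hexagonPos_inr {j l : Fin 3} (h : j ≠ l) (k : Fin 3) :
    signedArea (hexagonPos (Sum.inl k)) (hexagonPos (Sum.inr l)) (hexagonPos (Sum.inr j)) ≠ 0 := by
  fin_cases j <;> fin_cases l <;> fin_cases k <;> simp [Fin.reduceFinMk] at h ⊢ <;>
    simp [hexagonPos, signedArea] <;> norm_num

theorem straightDiagonals_edgeCurve (x : Fin 3 × Fin 3) :
    straightDiagonals.edgeCurve x = hexagonLine x.1 x.2 := by
  by_cases h : x.1 = x.2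
  · rw [HexagonDiagonals.edgeCurve, if_pos h, ← h]; rfl
  · exact HexagonDiagonals.edgeCurve_of_ne _ h

theorem isSimple_straightDiagonals : straightDiagonals.drawing.IsSimple := by
  refine ⟨fun e => ?_, fun e f hef => ?_⟩
  · obtain ⟨x, rfl⟩ := completeBipartiteEdgeEquiv.surjective e
    rw [HexagonDiagonals.drawing_curve, straightDiagonals_edgeCurve]
    exact hexagonLine_injective _ _
  · obtain ⟨x, rfl⟩ := completeBipartiteEdgeEquiv.surjective e
    obtain ⟨y, rfl⟩ := completeBipartiteEdgeEquiv.surjective f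
    rw [HexagonDiagonals.drawing_curve, HexagonDiagonals.drawing_curve,
      straightDiagonals_edgeCurve, straightDiagonals_edgeCurve]
    apply subsingleton_range_lineCurve_inter
    by_cases h : x.1 = y.1
    · exact Or.inr (signedArea_hexagonPos_inr
        (fun h' => hef (congrArg _ (Prod.ext h h'))) _)
    · exact Or.inl (signedArea_hexagonPos_inl h _)

end StraightHexagon

/-! ### The drawing with a self-crossing diagonal -/

section LoopedHexagon

/-- A polygonal path that leaves `Sum.inl 1` vertically, turns around and arrives at `Sum.inr 1`
horizontally, crossing itself once. -/
noncomputable def loopPoint (τ : ℝ) : ℂ :=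
  -- In units of `1 / 25` the path runs through `(7, 24)`, `(7, -9)`, `(9, -7)`, `(-24, -7)`,
  -- reached at `τ = 0, 33, 35, 68`. The turn lies on `x - y = 16`, just inside the hexagon side on
  -- `x - y = 17`.
  ⟨min (max 7 (τ - 26)) (44 - τ) / 25, max (24 - τ) (min (τ - 42) (-7)) / 25⟩

theorem loopPoint_of_le {τ : ℝ} (h : τ ≤ 33) : loopPoint τ = ⟨7 / 25, (24 - τ) / 25⟩ := by
  rw [loopPoint, max_eq_left (by linarith : τ - 26 ≤ 7), min_eq_left (by linarith : 7 ≤ 44 - τ),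
    min_eq_left (by linarith : τ - 42 ≤ -7), max_eq_left (by linarith : τ - 42 ≤ 24 - τ)]

theorem loopPoint_of_mem {τ : ℝ} (h : 33 ≤ τ) (h' : τ ≤ 35) :
    loopPoint τ = ⟨(τ - 26) / 25, (τ - 42) / 25⟩ := by
  rw [loopPoint, max_eq_right (by linarith : 7 ≤ τ - 26),
    min_eq_left (by linarith : τ - 26 ≤ 44 - τ),
    min_eq_left (by linarith : τ - 42 ≤ -7), max_eq_right (by linarith : 24 - τ ≤ τ - 42)]

theorem loopPoint_of_ge {τ : ℝ} (h : 35 ≤ τ) : loopPoint τ = ⟨(44 - τ) / 25, -7 / 25⟩ := by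
  rw [loopPoint, min_eq_right (le_max_of_le_right (by linarith) : 44 - τ ≤ max 7 (τ - 26)),
    min_eq_right (by linarith : -7 ≤ τ - 42), max_eq_right (by linarith : 24 - τ ≤ -7)]

/-- Case distinction along the three segments of the path. -/
theorem loopPoint_cases (τ : ℝ) : (τ ≤ 33 ∧ loopPoint τ = ⟨7 / 25, (24 - τ) / 25⟩) ∨
    (33 < τ ∧ τ < 35 ∧ loopPoint τ = ⟨(τ - 26) / 25, (τ - 42) / 25⟩) ∨
    (35 ≤ τ ∧ loopPoint τ = ⟨(44 - τ) / 25, -7 / 25⟩) := by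
  rcases le_or_gt τ 33 with h | h
  · exact Or.inl ⟨h, loopPoint_of_le h⟩
  rcases le_or_gt 35 τ with h' | h'
  · exact Or.inr (Or.inr ⟨h', loopPoint_of_ge h'⟩)
  · exact Or.inr (Or.inl ⟨h, h', loopPoint_of_mem h.le h'.le⟩)

theorem continuous_loopPoint : Continuous loopPoint := by
  refine Complex.equivRealProdCLM.symm.continuous.comp
    (f := fun τ : ℝ => (min (max 7 (τ - 26)) (44 - τ) / 25,
      max (24 - τ) (min (τ - 42) (-7)) / 25)) ?_
  fun_prop

/-- The factor 68 is the value of `τ` at which the path reaches `Sum.inr 1`. -/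
noncomputable def loopCurve : C(I, ℂ) where
  toFun t := loopPoint (68 * t)
  continuous_toFun := continuous_loopPoint.comp (by fun_prop)

theorem loopCurve_apply (t : I) : loopCurve t = loopPoint (68 * t) := rfl

theorem loopCurve_affine_of_lt {s : I} (hs : 68 * (s : ℝ) < 33) :
    ∀ᶠ u in 𝓝 s, loopCurve u = loopCurve s + ((u : ℝ) - s) • (⟨0, -68 / 25⟩ : ℂ) := by
  have : ∀ᶠ u : I in 𝓝 s, 68 * (u : ℝ) < 33 :=
    (by fun_prop : Continuous fun u : I => 68 * (u : ℝ)).continuousAt.eventually_lt_const hs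
  filter_upwards [this] with u hu
  rw [loopCurve_apply, loopCurve_apply, loopPoint_of_le hu.le, loopPoint_of_le hs.le]
  apply Complex.ext <;> simp
  ring

theorem loopCurve_affine_of_gt {s : I} (hs : 35 < 68 * (s : ℝ)) :
    ∀ᶠ u in 𝓝 s, loopCurve u = loopCurve s + ((u : ℝ) - s) • (⟨-68 / 25, 0⟩ : ℂ) := by
  have : ∀ᶠ u : I in 𝓝 s, 35 < 68 * (u : ℝ) :=
    (by fun_prop : Continuous fun u : I => 68 * (u : ℝ)).continuousAt.eventually_const_lt hs
  filter_upwards [this] with u hu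
  rw [loopCurve_apply, loopCurve_apply, loopPoint_of_ge hu.le, loopPoint_of_ge hs.le]
  apply Complex.ext <;> simp
  ring

theorem loopCurve_mem_ball {t : I} (h0 : t ≠ 0) (h1 : t ≠ 1) :
    loopCurve t ∈ Metric.ball (0 : ℂ) 1 := by
  have t0 : 0 < (t : ℝ) := unitInterval.pos_iff_ne_zero.2 h0
  have t1 : (t : ℝ) < 1 := unitInterval.lt_one_iff_ne_one.2 h1
  rw [mem_ball_zero_iff, ← sq_lt_one_iff₀ (norm_nonneg _), Complex.sq_norm, Complex.normSq_apply,
    loopCurve_apply]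
  rcases loopPoint_cases (68 * t) with ⟨h, e⟩ | ⟨h, h', e⟩ | ⟨h, e⟩ <;> rw [e] <;> simp only
  · nlinarith
  · nlinarith
  · nlinarith

theorem hexagonSlack_loopCurve_pos (t : I) (h0 : t ≠ 0) (h1 : t ≠ 1) (k l : Fin 3) (h : k ≠ l) :
    0 < hexagonSlack k l (loopCurve t) := by
  have t0 : 0 < (t : ℝ) := unitInterval.pos_iff_ne_zero.2 h0
  have t1 : (t : ℝ) < 1 := unitInterval.lt_one_iff_ne_one.2 h1
  rw [loopCurve_apply]
  rcases loopPoint_cases (68 * t) with ⟨h, e⟩ | ⟨h, h', e⟩ | ⟨h, e⟩ <;> rw [e] <;>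
    fin_cases k <;> fin_cases l <;> simp [Fin.reduceFinMk] at h ⊢ <;> simp [hexagonSlack] <;>
    first | contradiction | linarith

/-- The long diagonals of the hexagon, two of them straight and one with a loop. -/
noncomputable def loopedDiagonals : HexagonDiagonals where
  diag := ![hexagonLine 0 0, loopCurve, hexagonLine 2 2]
  diag_zero i := by
    fin_cases i
    · exact hexagonLine_zero 0 0
    · exact (loopPoint_of_le (by norm_num)).trans (by norm_num [hexagonPos])
    · exact hexagonLine_zero 2 2
  diag_one i := by
    fin_cases i
    · exact hexagonLine_one 0 0
    · exact (loopPoint_of_ge (by norm_num)).trans (by norm_num [hexagonPos])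
    · exact hexagonLine_one 2 2
  diag_mem_ball i t h0 h1 := by
    fin_cases i
    · exact hexagonLine_mem_ball 0 0 h0 h1
    · exact loopCurve_mem_ball h0 h1
    · exact hexagonLine_mem_ball 2 2 h0 h1
  slack_pos i t h0 h1 k l h := by
    fin_cases i
    · exact hexagonSlack_hexagonLine_diag_pos 0 t h0 h1 k l h
    · exact hexagonSlack_loopCurve_pos t h0 h1 k l h
    · exact hexagonSlack_hexagonLine_diag_pos 2 t h0 h1 k l h
  n := 4
  -- In units of `1 / 25` the crossings are `(-7, 7)`, `(7, 7)`, `(-7, -7)` and `(7, -7)`; the last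
  -- is the self-crossing, at `τ = 31` and `τ = 37`.
  fst := ![(0, ⟨17 / 48, by norm_num, by norm_num⟩), (0, ⟨31 / 48, by norm_num, by norm_num⟩),
    (1, ⟨51 / 68, by norm_num, by norm_num⟩), (1, ⟨31 / 68, by norm_num, by norm_num⟩)]
  snd := ![(2, ⟨31 / 48, by norm_num, by norm_num⟩), (1, ⟨17 / 68, by norm_num, by norm_num⟩),
    (2, ⟨17 / 48, by norm_num, by norm_num⟩), (1, ⟨37 / 68, by norm_num, by norm_num⟩)]
  fst_ne k := by
    fin_cases k <;> exact unitInterval.mk_ne_zero_and_ne_one _ (by norm_num) (by norm_num)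
  strands_injective := by
    intro a b h
    rcases a with a | a <;> rcases b with b | b <;> fin_cases a <;> fin_cases b <;>
      first
      | rfl
      | (exfalso; norm_num [Subtype.ext_iff] at h; done)
      | (exfalso; norm_num [Subtype.ext_iff] at h; exact absurd h (by decide))
  crossAt k := by
    fin_cases k
    · refine curvesCrossAt_of_affine ?_
        (Filter.Eventually.of_forall fun u => lineCurve_affine _ _ _ u)
        (Filter.Eventually.of_forall fun u => lineCurve_affine _ _ _ u) ?_
      · refine (hexagonLine_zero_zero _).trans (Eq.trans ?_ (hexagonLine_two_two _).symm)
        norm_num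
      · simp [hexagonPos]; norm_num
    · refine curvesCrossAt_of_affine ?_
        (Filter.Eventually.of_forall fun u => lineCurve_affine _ _ _ u)
        (loopCurve_affine_of_lt (by norm_num)) ?_
      · refine (hexagonLine_zero_zero _).trans
          (Eq.trans ?_ (loopPoint_of_le (by norm_num)).symm)
        norm_num
      · simp [hexagonPos]; norm_num
    · refine curvesCrossAt_of_affine ?_ (loopCurve_affine_of_gt (by norm_num))
        (Filter.Eventually.of_forall fun u => lineCurve_affine _ _ _ u) ?_
      · refine (loopPoint_of_ge (by norm_num)).trans
          (Eq.trans ?_ (hexagonLine_two_two _).symm)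
        norm_num
      · simp [hexagonPos]; norm_num
    · refine curvesCrossAt_of_affine ?_ (loopCurve_affine_of_lt (by norm_num))
        (loopCurve_affine_of_gt (by norm_num)) ?_
      · refine (loopPoint_of_le (by norm_num)).trans
          (Eq.trans ?_ (loopPoint_of_ge (by norm_num)).symm)
        norm_num
      · norm_num
  eq_fst_snd := by
    have h02 : ∀ s t : I, hexagonLine 0 0 s = hexagonLine 2 2 t →
        (s : ℝ) = 17 / 48 ∧ (t : ℝ) = 31 / 48 := by
      intro s t h
      rw [hexagonLine_zero_zero, hexagonLine_two_two, Complex.mk.injEq] at h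
      constructor <;> linarith [h.1, h.2]
    have h01 : ∀ s t : I, hexagonLine 0 0 s = loopCurve t →
        (s : ℝ) = 31 / 48 ∧ (t : ℝ) = 17 / 68 := by
      intro s t h
      rw [hexagonLine_zero_zero, loopCurve_apply] at h
      rcases loopPoint_cases (68 * t) with ⟨h1, e⟩ | ⟨h1, h2, e⟩ | ⟨h1, e⟩ <;>
        rw [e, Complex.mk.injEq] at h <;> constructor <;> linarith [h.1, h.2]
    have h12 : ∀ s t : I, loopCurve s = hexagonLine 2 2 t →
        (s : ℝ) = 51 / 68 ∧ (t : ℝ) = 17 / 48 := by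
      intro s t h
      rw [hexagonLine_two_two, loopCurve_apply] at h
      rcases loopPoint_cases (68 * s) with ⟨h1, e⟩ | ⟨h1, h2, e⟩ | ⟨h1, e⟩ <;>
        rw [e, Complex.mk.injEq] at h <;> constructor <;> linarith [h.1, h.2]
    have h11 : ∀ s t : I, s ≠ t → loopCurve s = loopCurve t →
        ((s : ℝ) = 31 / 68 ∧ (t : ℝ) = 37 / 68) ∨ ((s : ℝ) = 37 / 68 ∧ (t : ℝ) = 31 / 68) := by
      intro s t hst h
      rw [loopCurve_apply, loopCurve_apply] at h
      have hst' : (s : ℝ) ≠ t := fun h => hst (Subtype.ext h)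
      rcases loopPoint_cases (68 * s) with ⟨h1, e⟩ | ⟨h1, h2, e⟩ | ⟨h1, e⟩ <;>
        rcases loopPoint_cases (68 * t) with ⟨h3, e'⟩ | ⟨h3, h4, e'⟩ | ⟨h3, e'⟩ <;>
        rw [e, e', Complex.mk.injEq] at h <;>
        first
        | exact absurd (by linarith [h.1, h.2]) hst'
        | exact Or.inl ⟨by linarith [h.1, h.2], by linarith [h.1, h.2]⟩
        | exact Or.inr ⟨by linarith [h.1, h.2], by linarith [h.1, h.2]⟩
    rintro ⟨i, s⟩ ⟨j, t⟩ hne heq - - - -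
    simp only at heq
    fin_cases i <;> fin_cases j
    · exact absurd (congrArg (Prod.mk 0) (hexagonLine_injective 0 0 heq)) hne
    · obtain ⟨h1, h2⟩ := h01 s t heq
      exact ⟨1, Or.inl ⟨Prod.ext rfl (Subtype.ext h1), Prod.ext rfl (Subtype.ext h2)⟩⟩
    · obtain ⟨h1, h2⟩ := h02 s t heq
      exact ⟨0, Or.inl ⟨Prod.ext rfl (Subtype.ext h1), Prod.ext rfl (Subtype.ext h2)⟩⟩
    · obtain ⟨h1, h2⟩ := h01 t s heq.symm
      exact ⟨1, Or.inr ⟨Prod.ext rfl (Subtype.ext h2), Prod.ext rfl (Subtype.ext h1)⟩⟩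
    · rcases h11 s t (fun h => hne (by rw [h])) heq with ⟨h1, h2⟩ | ⟨h1, h2⟩
      · exact ⟨3, Or.inl ⟨Prod.ext rfl (Subtype.ext h1), Prod.ext rfl (Subtype.ext h2)⟩⟩
      · exact ⟨3, Or.inr ⟨Prod.ext rfl (Subtype.ext h1), Prod.ext rfl (Subtype.ext h2)⟩⟩
    · obtain ⟨h1, h2⟩ := h12 s t heq
      exact ⟨2, Or.inl ⟨Prod.ext rfl (Subtype.ext h1), Prod.ext rfl (Subtype.ext h2)⟩⟩
    · obtain ⟨h1, h2⟩ := h02 t s heq.symm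
      exact ⟨0, Or.inr ⟨Prod.ext rfl (Subtype.ext h2), Prod.ext rfl (Subtype.ext h1)⟩⟩
    · obtain ⟨h1, h2⟩ := h12 t s heq.symm
      exact ⟨2, Or.inr ⟨Prod.ext rfl (Subtype.ext h2), Prod.ext rfl (Subtype.ext h1)⟩⟩
    · exact absurd (congrArg (Prod.mk 2) (hexagonLine_injective 2 2 heq)) hne

end LoopedHexagon

/-! ### The crossings of the looped drawing form one bundled crossing -/

section LoopedHexagonBundling

theorem connectedComponentIn_Icc {a b t : I} (ht : t ∈ Icc a b) :
    connectedComponentIn (Icc a b) t = Icc a b :=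
  isPreconnected_Icc.connectedComponentIn ht

/-- Preconnected sets of parameters are order connected, so a component that meets both intervals
would contain a point of the gap. -/
theorem connectedComponentIn_Icc_union_left {a b c d t : I} (hbc : b < c) (ht : t ∈ Icc a b) :
    connectedComponentIn (Icc a b ∪ Icc c d) t = Icc a b := by
  refine Subset.antisymm (fun u hu => ?_)
    (isPreconnected_Icc.subset_connectedComponentIn ht subset_union_left)
  rcases connectedComponentIn_subset _ _ hu with h | h
  · exact h
  obtain ⟨m, hm1, hm2⟩ := exists_between hbc
  have hc : (connectedComponentIn (Icc a b ∪ Icc c d) t).OrdConnected :=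
    isPreconnected_connectedComponentIn.ordConnected
  have hm := connectedComponentIn_subset _ _
    (hc.out (mem_connectedComponentIn (Or.inl ht)) hu ⟨ht.2.trans hm1.le, hm2.le.trans h.1⟩)
  exact (hm.elim (fun h' => absurd h'.2 hm1.not_ge) fun h' => absurd h'.1 hm2.not_ge)

theorem connectedComponentIn_Icc_union_right {a b c d t : I} (hbc : b < c) (ht : t ∈ Icc c d) :
    connectedComponentIn (Icc a b ∪ Icc c d) t = Icc c d := by
  refine Subset.antisymm (fun u hu => ?_)
    (isPreconnected_Icc.subset_connectedComponentIn ht subset_union_right)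
  rcases connectedComponentIn_subset _ _ hu with h | h
  · obtain ⟨m, hm1, hm2⟩ := exists_between hbc
    have hc : (connectedComponentIn (Icc a b ∪ Icc c d) t).OrdConnected :=
      isPreconnected_connectedComponentIn.ordConnected
    have hm := connectedComponentIn_subset _ _
      (hc.out hu (mem_connectedComponentIn (Or.inr ht)) ⟨h.2.trans hm1.le, hm2.le.trans ht.1⟩)
    exact (hm.elim (fun h' => absurd h'.2 hm1.not_ge) fun h' => absurd h'.1 hm2.not_ge)
  · exact h

/-- The square whose corners are the crossings of the drawing given by `loopedDiagonals`. -/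
def crossingSquare : Set ℂ := {z | z.re ∈ Icc (-7 / 25) (7 / 25) ∧ z.im ∈ Icc (-7 / 25) (7 / 25)}

/-- The piece of the diagonal of index `0` or `2` in the square. -/
def straightPiece : Set I :=
  Icc ⟨17 / 48, by norm_num, by norm_num⟩ ⟨31 / 48, by norm_num, by norm_num⟩

/-- The vertical piece of the looped diagonal in the square. -/
def loopPieceVertical : Set I :=
  Icc ⟨17 / 68, by norm_num, by norm_num⟩ ⟨31 / 68, by norm_num, by norm_num⟩

/-- The horizontal piece of the looped diagonal in the square. -/
def loopPieceHorizontal : Set I :=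
  Icc ⟨37 / 68, by norm_num, by norm_num⟩ ⟨51 / 68, by norm_num, by norm_num⟩

theorem mem_straightPiece {t : I} :
    t ∈ straightPiece ↔ 17 / 48 ≤ (t : ℝ) ∧ (t : ℝ) ≤ 31 / 48 := Iff.rfl

theorem mem_loopPieceVertical {t : I} :
    t ∈ loopPieceVertical ↔ 17 / 68 ≤ (t : ℝ) ∧ (t : ℝ) ≤ 31 / 68 := Iff.rfl

theorem mem_loopPieceHorizontal {t : I} :
    t ∈ loopPieceHorizontal ↔ 37 / 68 ≤ (t : ℝ) ∧ (t : ℝ) ≤ 51 / 68 := Iff.rfl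

theorem hexagonLine_zero_preimage : hexagonLine 0 0 ⁻¹' crossingSquare = straightPiece := by
  ext t
  rw [mem_preimage, hexagonLine_zero_zero, mem_straightPiece]
  simp only [crossingSquare, mem_ofPred_eq, mem_Icc]
  constructor
  · rintro ⟨⟨h1, h2⟩, -⟩; constructor <;> linarith
  · rintro ⟨h1, h2⟩; refine ⟨⟨?_, ?_⟩, ?_, ?_⟩ <;> linarith

theorem hexagonLine_two_preimage : hexagonLine 2 2 ⁻¹' crossingSquare = straightPiece := by
  ext t
  rw [mem_preimage, hexagonLine_two_two, mem_straightPiece]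
  simp only [crossingSquare, mem_ofPred_eq, mem_Icc]
  constructor
  · rintro ⟨-, h1, h2⟩; constructor <;> linarith
  · rintro ⟨h1, h2⟩; refine ⟨⟨?_, ?_⟩, ?_, ?_⟩ <;> linarith

/-- The turn lies to the right of the square, so the curve visits the square twice. -/
theorem loopCurve_preimage :
    loopCurve ⁻¹' crossingSquare = loopPieceVertical ∪ loopPieceHorizontal := by
  ext t
  rw [mem_preimage, loopCurve_apply, mem_union, mem_loopPieceVertical, mem_loopPieceHorizontal]
  simp only [crossingSquare, mem_ofPred_eq, mem_Icc]
  rcases loopPoint_cases (68 * t) with ⟨h1, e⟩ | ⟨h1, h2, e⟩ | ⟨h1, e⟩ <;> rw [e] <;> simp only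
  · constructor
    · rintro ⟨-, h3, h4⟩; left; constructor <;> linarith
    · rintro (⟨h3, h4⟩ | ⟨h3, h4⟩)
      · refine ⟨⟨?_, ?_⟩, ?_, ?_⟩ <;> linarith
      · linarith
  · constructor
    · rintro ⟨⟨h3, h4⟩, h5, h6⟩; linarith
    · rintro (⟨h3, h4⟩ | ⟨h3, h4⟩) <;> linarith
  · constructor
    · rintro ⟨⟨h3, h4⟩, -⟩; right; constructor <;> linarith
    · rintro (⟨h3, h4⟩ | ⟨h3, h4⟩)
      · linarith
      · refine ⟨⟨?_, ?_⟩, ?_, ?_⟩ <;> linarith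

theorem hexagonSlack_pos_of_mem_crossingSquare {z : ℂ} (hz : z ∈ crossingSquare) {i j : Fin 3}
    (h : i ≠ j) : 0 < hexagonSlack i j z := by
  obtain ⟨⟨h1, h2⟩, h3, h4⟩ := hz
  fin_cases i <;> fin_cases j <;> simp [Fin.reduceFinMk] at h ⊢ <;> simp [hexagonSlack] <;> linarith

theorem hexagonLine_zero_image :
    hexagonLine 0 0 '' straightPiece = {z | z.re ∈ Icc (-7 / 25) (7 / 25) ∧ z.im = 7 / 25} := by
  ext z
  constructor
  · rintro ⟨t, ht, rfl⟩
    rw [mem_straightPiece] at ht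
    rw [hexagonLine_zero_zero]
    exact ⟨⟨by simp only; linarith, by simp only; linarith⟩, rfl⟩
  · rintro ⟨⟨h1, h2⟩, h3⟩
    refine ⟨⟨(25 * z.re + 24) / 48, by linarith, by linarith⟩, ?_, ?_⟩
    · rw [mem_straightPiece]; constructor <;> simp only <;> linarith
    · rw [hexagonLine_zero_zero]; apply Complex.ext <;> simp only <;> linarith

theorem hexagonLine_two_image :
    hexagonLine 2 2 '' straightPiece = {z | z.re = -7 / 25 ∧ z.im ∈ Icc (-7 / 25) (7 / 25)} := by
  ext z
  constructor
  · rintro ⟨t, ht, rfl⟩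
    rw [mem_straightPiece] at ht
    rw [hexagonLine_two_two]
    exact ⟨rfl, ⟨by simp only; linarith, by simp only; linarith⟩⟩
  · rintro ⟨h3, ⟨h1, h2⟩⟩
    refine ⟨⟨(25 * z.im + 24) / 48, by linarith, by linarith⟩, ?_, ?_⟩
    · rw [mem_straightPiece]; constructor <;> simp only <;> linarith
    · rw [hexagonLine_two_two]; apply Complex.ext <;> simp only <;> linarith

theorem loopCurve_image_vertical :
    loopCurve '' loopPieceVertical = {z | z.re = 7 / 25 ∧ z.im ∈ Icc (-7 / 25) (7 / 25)} := by
  ext z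
  constructor
  · rintro ⟨t, ht, rfl⟩
    rw [mem_loopPieceVertical] at ht
    rw [loopCurve_apply, loopPoint_of_le (by linarith)]
    exact ⟨rfl, ⟨by simp only; linarith, by simp only; linarith⟩⟩
  · rintro ⟨h3, ⟨h1, h2⟩⟩
    refine ⟨⟨(24 - 25 * z.im) / 68, by linarith, by linarith⟩, ?_, ?_⟩
    · rw [mem_loopPieceVertical]; constructor <;> simp only <;> linarith
    · rw [loopCurve_apply, loopPoint_of_le (by simp only; linarith)]
      apply Complex.ext <;> simp only <;> linarith

theorem loopCurve_image_horizontal :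
    loopCurve '' loopPieceHorizontal =
      {z | z.re ∈ Icc (-7 / 25) (7 / 25) ∧ z.im = -7 / 25} := by
  ext z
  constructor
  · rintro ⟨t, ht, rfl⟩
    rw [mem_loopPieceHorizontal] at ht
    rw [loopCurve_apply, loopPoint_of_ge (by linarith)]
    exact ⟨⟨by simp only; linarith, by simp only; linarith⟩, rfl⟩
  · rintro ⟨⟨h1, h2⟩, h3⟩
    refine ⟨⟨(44 - 25 * z.re) / 68, by linarith, by linarith⟩, ?_, ?_⟩
    · rw [mem_loopPieceHorizontal]; constructor <;> simp only <;> linarith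
    · rw [loopCurve_apply, loopPoint_of_ge (by simp only; linarith)]
      apply Complex.ext <;> simp only <;> linarith

/-- The long diagonals as edges of `K₃,₃`. -/
noncomputable def diagonalEdge (i : Fin 3) :
    (completeBipartiteGraph (Fin 3) (Fin 3)).edgeSet := completeBipartiteEdgeEquiv (i, i)

theorem diagonalEdge_injective : Function.Injective diagonalEdge := fun _ _ h =>
  (Prod.mk.inj (completeBipartiteEdgeEquiv.injective h)).1

theorem looped_curve_zero : loopedDiagonals.drawing.curve (diagonalEdge 0) = hexagonLine 0 0 := by
  rw [diagonalEdge, HexagonDiagonals.drawing_curve, HexagonDiagonals.edgeCurve_diag]; rfl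

theorem looped_curve_one : loopedDiagonals.drawing.curve (diagonalEdge 1) = loopCurve := by
  rw [diagonalEdge, HexagonDiagonals.drawing_curve, HexagonDiagonals.edgeCurve_diag]; rfl

theorem looped_curve_two : loopedDiagonals.drawing.curve (diagonalEdge 2) = hexagonLine 2 2 := by
  rw [diagonalEdge, HexagonDiagonals.drawing_curve, HexagonDiagonals.edgeCurve_diag]; rfl

/-- The pieces on the top and the bottom of the square. -/
noncomputable def horizontalBundle :
    Set ((completeBipartiteGraph (Fin 3) (Fin 3)).edgeSet × Set I) :=
  {(diagonalEdge 0, straightPiece), (diagonalEdge 1, loopPieceHorizontal)}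

/-- The pieces on the left and the right of the square. -/
noncomputable def verticalBundle :
    Set ((completeBipartiteGraph (Fin 3) (Fin 3)).edgeSet × Set I) :=
  {(diagonalEdge 2, straightPiece), (diagonalEdge 1, loopPieceVertical)}

/-- Sides of the hexagon miss the square because their slack is positive on it. The looped diagonal
contributes one piece to each bundle, which an edge of a simple drawing cannot do. -/
theorem looped_pieces :
    loopedDiagonals.drawing.pieces crossingSquare = horizontalBundle ∪ verticalBundle := by
  have hlt : (⟨31 / 68, by norm_num, by norm_num⟩ : I) < ⟨37 / 68, by norm_num, by norm_num⟩ :=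
    Subtype.mk_lt_mk.2 (by norm_num)
  ext ⟨e, J⟩
  constructor
  · rintro ⟨t, ht, hJ⟩
    simp only at ht hJ
    obtain ⟨⟨i, j⟩, rfl⟩ := completeBipartiteEdgeEquiv.surjective e
    by_cases hij : i = j
    swap
    · exfalso
      rw [HexagonDiagonals.drawing_curve, HexagonDiagonals.edgeCurve_of_ne _ hij] at ht
      exact (hexagonSlack_pos_of_mem_crossingSquare ht hij).ne'
        (hexagonSlack_hexagonLine_self hij t)
    subst hij
    change t ∈ loopedDiagonals.drawing.curve (diagonalEdge i) ⁻¹' crossingSquare at ht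
    change J = connectedComponentIn
      (loopedDiagonals.drawing.curve (diagonalEdge i) ⁻¹' crossingSquare) t at hJ
    obtain rfl | rfl | rfl : i = 0 ∨ i = 1 ∨ i = 2 := by fin_cases i <;> simp
    · rw [looped_curve_zero, hexagonLine_zero_preimage] at ht hJ
      rw [straightPiece, connectedComponentIn_Icc ht] at hJ
      subst hJ
      exact Or.inl (Or.inl rfl)
    · rw [looped_curve_one, loopCurve_preimage] at ht hJ
      rcases ht with ht | ht
      · rw [loopPieceVertical, loopPieceHorizontal,
          connectedComponentIn_Icc_union_left hlt ht] at hJ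
        subst hJ
        exact Or.inr (Or.inr rfl)
      · rw [loopPieceVertical, loopPieceHorizontal,
          connectedComponentIn_Icc_union_right hlt ht] at hJ
        subst hJ
        exact Or.inl (Or.inr rfl)
    · rw [looped_curve_two, hexagonLine_two_preimage] at ht hJ
      rw [straightPiece, connectedComponentIn_Icc ht] at hJ
      subst hJ
      exact Or.inr (Or.inl rfl)
  · have hs : (⟨17 / 48, by norm_num, by norm_num⟩ : I) ∈ straightPiece := by
      rw [mem_straightPiece]; norm_num
    have hv : (⟨17 / 68, by norm_num, by norm_num⟩ : I) ∈ loopPieceVertical := by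
      rw [mem_loopPieceVertical]; norm_num
    have hh : (⟨37 / 68, by norm_num, by norm_num⟩ : I) ∈ loopPieceHorizontal := by
      rw [mem_loopPieceHorizontal]; norm_num
    rintro ((h | h) | (h | h)) <;> obtain ⟨rfl, rfl⟩ := Prod.mk.inj h
    · refine ⟨⟨17 / 48, by norm_num, by norm_num⟩, ?_, ?_⟩ <;>
        simp only [looped_curve_zero, hexagonLine_zero_preimage]
      exacts [hs, (connectedComponentIn_Icc hs).symm]
    · refine ⟨⟨37 / 68, by norm_num, by norm_num⟩, ?_, ?_⟩ <;>
        simp only [looped_curve_one, loopCurve_preimage]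
      exacts [Or.inr hh, (connectedComponentIn_Icc_union_right hlt hh).symm]
    · refine ⟨⟨17 / 48, by norm_num, by norm_num⟩, ?_, ?_⟩ <;>
        simp only [looped_curve_two, hexagonLine_two_preimage]
      exacts [hs, (connectedComponentIn_Icc hs).symm]
    · refine ⟨⟨17 / 68, by norm_num, by norm_num⟩, ?_, ?_⟩ <;>
        simp only [looped_curve_one, loopCurve_preimage]
      exacts [Or.inl hv, (connectedComponentIn_Icc_union_left hlt hv).symm]

theorem trace_top : loopedDiagonals.drawing.trace (diagonalEdge 0, straightPiece) =
    {z | z.re ∈ Icc (-7 / 25) (7 / 25) ∧ z.im = 7 / 25} := by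
  rw [GraphDrawing.trace, looped_curve_zero, hexagonLine_zero_image]

theorem trace_bottom : loopedDiagonals.drawing.trace (diagonalEdge 1, loopPieceHorizontal) =
    {z | z.re ∈ Icc (-7 / 25) (7 / 25) ∧ z.im = -7 / 25} := by
  rw [GraphDrawing.trace, looped_curve_one, loopCurve_image_horizontal]

theorem trace_left : loopedDiagonals.drawing.trace (diagonalEdge 2, straightPiece) =
    {z | z.re = -7 / 25 ∧ z.im ∈ Icc (-7 / 25) (7 / 25)} := by
  rw [GraphDrawing.trace, looped_curve_two, hexagonLine_two_image]

theorem trace_right : loopedDiagonals.drawing.trace (diagonalEdge 1, loopPieceVertical) =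
    {z | z.re = 7 / 25 ∧ z.im ∈ Icc (-7 / 25) (7 / 25)} := by
  rw [GraphDrawing.trace, looped_curve_one, loopCurve_image_vertical]

theorem looped_crossings : loopedDiagonals.drawing.crossings =
    {⟨-7 / 25, 7 / 25⟩, ⟨7 / 25, 7 / 25⟩, ⟨-7 / 25, -7 / 25⟩, ⟨7 / 25, -7 / 25⟩} := by
  have h0 : loopedDiagonals.diag (loopedDiagonals.fst (0 : Fin 4)).1
      (loopedDiagonals.fst (0 : Fin 4)).2 = ⟨-7 / 25, 7 / 25⟩ :=
    (hexagonLine_zero_zero ⟨17 / 48, by norm_num, by norm_num⟩).trans (by norm_num)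
  have h1 : loopedDiagonals.diag (loopedDiagonals.fst (1 : Fin 4)).1
      (loopedDiagonals.fst (1 : Fin 4)).2 = ⟨7 / 25, 7 / 25⟩ :=
    (hexagonLine_zero_zero ⟨31 / 48, by norm_num, by norm_num⟩).trans (by norm_num)
  have h2 : loopedDiagonals.diag (loopedDiagonals.fst (2 : Fin 4)).1
      (loopedDiagonals.fst (2 : Fin 4)).2 = ⟨-7 / 25, -7 / 25⟩ :=
    (loopPoint_of_ge (τ := 68 * (51 / 68)) (by norm_num)).trans (by norm_num)
  have h3 : loopedDiagonals.diag (loopedDiagonals.fst (3 : Fin 4)).1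
      (loopedDiagonals.fst (3 : Fin 4)).2 = ⟨7 / 25, -7 / 25⟩ :=
    (loopPoint_of_le (τ := 68 * (31 / 68)) (by norm_num)).trans (by norm_num)
  ext p
  rw [HexagonDiagonals.mem_crossings_iff]
  change (∃ k : Fin 4, _) ↔ _
  rw [Fin.exists_fin_succ, Fin.exists_fin_succ, Fin.exists_fin_two]
  exact or_congr (by rw [← h0]) (or_congr (by rw [← h1]; rfl)
    (or_congr (by rw [← h2]; rfl) (by rw [← h3]; rfl)))

/-- The standard parametrization of the square. -/
noncomputable def crossingSquareMap : C(I × I, ℂ) where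
  -- The first coordinate runs downwards and the second to the right, so the sides come in the order
  -- top, left, bottom, right required by `IsJordanFrame`.
  toFun x := ⟨(-7 + 14 * x.2) / 25, (7 - 14 * x.1) / 25⟩
  continuous_toFun := by
    refine Complex.equivRealProdCLM.symm.continuous.comp
      (f := fun x : I × I => ((-7 + 14 * (x.2 : ℝ)) / 25, (7 - 14 * (x.1 : ℝ)) / 25)) ?_
    fun_prop

theorem crossingSquareMap_apply (x : I × I) :
    crossingSquareMap x = ⟨(-7 + 14 * x.2) / 25, (7 - 14 * x.1) / 25⟩ := rfl

theorem mem_crossingSquareMap_image {S : Set (I × I)} {z : ℂ} (hz : z ∈ crossingSquare)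
    (h : ∀ x : I × I, (x.2 : ℝ) = (7 + 25 * z.re) / 14 → (x.1 : ℝ) = (7 - 25 * z.im) / 14 → x ∈ S) :
    z ∈ crossingSquareMap '' S := by
  obtain ⟨⟨h1, h2⟩, h3, h4⟩ := hz
  refine ⟨(⟨(7 - 25 * z.im) / 14, by linarith, by linarith⟩,
    ⟨(7 + 25 * z.re) / 14, by linarith, by linarith⟩), h _ rfl rfl, ?_⟩
  rw [crossingSquareMap_apply]
  apply Complex.ext <;> simp only <;> ring

theorem crossingSquareMap_mem (x : I × I) : crossingSquareMap x ∈ crossingSquare := by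
  obtain ⟨⟨s, s0, s1⟩, ⟨t, t0, t1⟩⟩ := x
  rw [crossingSquareMap_apply]
  refine ⟨⟨?_, ?_⟩, ?_, ?_⟩ <;> simp only <;> linarith

theorem isJordanFrame_crossingSquare : loopedDiagonals.drawing.IsJordanFrame crossingSquare
    (diagonalEdge 0, straightPiece) (diagonalEdge 2, straightPiece)
    (diagonalEdge 1, loopPieceHorizontal) (diagonalEdge 1, loopPieceVertical) := by
  refine ⟨crossingSquareMap, ?_, ?_, ?_, ?_, ?_, ?_⟩
  · rintro ⟨s, t⟩ ⟨s', t'⟩ h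
    rw [crossingSquareMap_apply, crossingSquareMap_apply, Complex.mk.injEq] at h
    exact Prod.ext (Subtype.ext (by simp only at h ⊢; linarith [h.2]))
      (Subtype.ext (by simp only at h ⊢; linarith [h.1]))
  · rw [← image_univ]
    refine Subset.antisymm ?_ fun z hz => mem_crossingSquareMap_image hz fun _ _ _ => mem_univ _
    rintro _ ⟨x, -, rfl⟩
    exact crossingSquareMap_mem x
  · rw [trace_top]
    refine Subset.antisymm ?_ fun z hz => mem_crossingSquareMap_image
      ⟨hz.1, by rw [hz.2]; norm_num⟩ fun x _ h => Subtype.ext (by rw [h, hz.2]; norm_num)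
    rintro _ ⟨x, hx, rfl⟩
    refine ⟨(crossingSquareMap_mem x).1, ?_⟩
    rw [crossingSquareMap_apply, show x.1 = 0 from hx]; norm_num
  · rw [trace_left]
    refine Subset.antisymm ?_ fun z hz => mem_crossingSquareMap_image
      ⟨by rw [hz.1]; norm_num, hz.2⟩ fun x h _ => Subtype.ext (by rw [h, hz.1]; norm_num)
    rintro _ ⟨x, hx, rfl⟩
    refine ⟨?_, (crossingSquareMap_mem x).2⟩
    rw [crossingSquareMap_apply, show x.2 = 0 from hx]; norm_num
  · rw [trace_bottom]
    refine Subset.antisymm ?_ fun z hz => mem_crossingSquareMap_image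
      ⟨hz.1, by rw [hz.2]; norm_num⟩ fun x _ h => Subtype.ext (by rw [h, hz.2]; norm_num)
    rintro _ ⟨x, hx, rfl⟩
    refine ⟨(crossingSquareMap_mem x).1, ?_⟩
    rw [crossingSquareMap_apply, show x.1 = 1 from hx]; norm_num
  · rw [trace_right]
    refine Subset.antisymm ?_ fun z hz => mem_crossingSquareMap_image
      ⟨by rw [hz.1]; norm_num, hz.2⟩ fun x h _ => Subtype.ext (by rw [h, hz.1]; norm_num)
    rintro _ ⟨x, hx, rfl⟩
    refine ⟨?_, (crossingSquareMap_mem x).2⟩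
    rw [crossingSquareMap_apply, show x.2 = 1 from hx]; norm_num

theorem horizontal_inter_vertical {x y : ℝ} (hx : x ∈ Icc (-7 / 25 : ℝ) (7 / 25))
    (hy : y ∈ Icc (-7 / 25 : ℝ) (7 / 25)) :
    {z : ℂ | z.re ∈ Icc (-7 / 25) (7 / 25) ∧ z.im = y} ∩
      {z : ℂ | z.re = x ∧ z.im ∈ Icc (-7 / 25) (7 / 25)} = {⟨x, y⟩} := by
  ext z
  constructor
  · rintro ⟨⟨-, h1⟩, h2, -⟩
    exact Complex.ext h2 h1
  · rintro rfl
    exact ⟨⟨hx, rfl⟩, rfl, hy⟩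

theorem isBundledCrossing_looped_crossings :
    loopedDiagonals.drawing.IsBundledCrossing loopedDiagonals.drawing.crossings := by
  have hm : (-7 / 25 : ℝ) ∈ Icc (-7 / 25 : ℝ) (7 / 25) := by norm_num
  have hp : (7 / 25 : ℝ) ∈ Icc (-7 / 25 : ℝ) (7 / 25) := by norm_num
  refine ⟨crossingSquare, horizontalBundle, verticalBundle, ?_, looped_pieces, ?_, ?_, ?_, ?_, ?_,
    _, Or.inl rfl, _, Or.inl rfl, _, Or.inr rfl, _, Or.inr rfl,
    Or.inl isJordanFrame_crossingSquare⟩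
  · rw [looped_crossings, eq_comm, inter_eq_left]
    rintro z (rfl | rfl | rfl | rfl)
    exacts [⟨hm, hp⟩, ⟨hp, hp⟩, ⟨hm, hm⟩, ⟨hp, hm⟩]
  · have hne : loopPieceHorizontal ≠ loopPieceVertical := by
      intro h
      have : (⟨37 / 68, by norm_num, by norm_num⟩ : I) ∈ loopPieceHorizontal := by
        rw [mem_loopPieceHorizontal]; norm_num
      rw [h, mem_loopPieceVertical] at this
      norm_num at this
    rw [disjoint_left]
    rintro a (rfl | rfl) (h | h)
    · exact absurd (diagonalEdge_injective (Prod.mk.inj h).1) (by decide)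
    · exact absurd (diagonalEdge_injective (Prod.mk.inj h).1) (by decide)
    · exact absurd (diagonalEdge_injective (Prod.mk.inj h).1) (by decide)
    · exact hne (Prod.mk.inj h).2
  · rw [looped_pieces]
    rintro a ((rfl | rfl) | (rfl | rfl)) <;> simp only
    · rw [looped_curve_zero]; exact (hexagonLine_injective 0 0).injOn
    · rw [looped_curve_one]
      intro s hs t ht h
      rw [mem_loopPieceHorizontal] at hs ht
      rw [loopCurve_apply, loopCurve_apply, loopPoint_of_ge (by linarith),
        loopPoint_of_ge (by linarith), Complex.mk.injEq] at h
      exact Subtype.ext (by linarith [h.1])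
    · rw [looped_curve_two]; exact (hexagonLine_injective 2 2).injOn
    · rw [looped_curve_one]
      intro s hs t ht h
      rw [mem_loopPieceVertical] at hs ht
      rw [loopCurve_apply, loopCurve_apply, loopPoint_of_le (by linarith),
        loopPoint_of_le (by linarith), Complex.mk.injEq] at h
      exact Subtype.ext (by linarith [h.2])
  · rw [looped_crossings]
    rintro a (rfl | rfl) b (rfl | rfl)
    · rw [trace_top, trace_left, horizontal_inter_vertical hm hp]
      exact ⟨_, by simp, rfl⟩
    · rw [trace_top, trace_right, horizontal_inter_vertical hp hp]
      exact ⟨_, by simp, rfl⟩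
    · rw [trace_bottom, trace_left, horizontal_inter_vertical hm hm]
      exact ⟨_, by simp, rfl⟩
    · rw [trace_bottom, trace_right, horizontal_inter_vertical hp hm]
      exact ⟨_, by simp, rfl⟩
  · refine pairwise_pair.2 fun _ => ?_
    have : Disjoint (loopedDiagonals.drawing.trace (diagonalEdge 0, straightPiece))
        (loopedDiagonals.drawing.trace (diagonalEdge 1, loopPieceHorizontal)) := by
      rw [trace_top, trace_bottom, disjoint_left]
      rintro z ⟨-, h1⟩ ⟨-, h2⟩
      rw [h1] at h2; norm_num at h2
    exact ⟨this, this.symm⟩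
  · refine pairwise_pair.2 fun _ => ?_
    have : Disjoint (loopedDiagonals.drawing.trace (diagonalEdge 2, straightPiece))
        (loopedDiagonals.drawing.trace (diagonalEdge 1, loopPieceVertical)) := by
      rw [trace_left, trace_right, disjoint_left]
      rintro z ⟨h1, -⟩ ⟨h2, -⟩
      rw [h1] at h2; norm_num at h2
    exact ⟨this, this.symm⟩

theorem isBundling_looped_crossings :
    loopedDiagonals.drawing.IsBundling {loopedDiagonals.drawing.crossings} := by
  refine ⟨fun B hB => ?_, by simp, by simp⟩
  rw [Finset.mem_singleton.1 hB]
  exact ⟨GraphDrawing.crossings_nonempty loopedDiagonals.isCircular_drawing,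
    isBundledCrossing_looped_crossings⟩

end LoopedHexagonBundling

/-! ### The two crossing numbers -/

theorem mainTheorem6 :
    nonsimpleCircularBundledCrossingNumber (completeBipartiteGraph (Fin 3) (Fin 3)) = 1 ∧
      1 < circularBundledCrossingNumber (completeBipartiteGraph (Fin 3) (Fin 3)) := by
  constructor
  · have hmem : 1 ∈ {k | ∃ D : GraphDrawing (completeBipartiteGraph (Fin 3) (Fin 3)),
        D.IsCircular ∧ ∃ P : Finset (Set ℂ), D.IsBundling P ∧ P.card = k} :=
      ⟨_, loopedDiagonals.isCircular_drawing, _, isBundling_looped_crossings, by simp⟩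
    refine le_antisymm (Nat.sInf_le hmem) (le_csInf ⟨1, hmem⟩ ?_)
    rintro k ⟨D, hD, P, hP, rfl⟩
    exact Nat.one_le_iff_ne_zero.2 (GraphDrawing.card_ne_zero_of_isBundling hD hP)
  -- The infimum of the empty set is 0 in `ℕ`, so the lower bound needs a simple circular drawing
  -- that has a bundling.
  · obtain ⟨P, hP⟩ := isSimple_straightDiagonals.exists_isBundling
    refine Nat.lt_iff_add_one_le.2 (le_csInf ⟨_, straightDiagonals.drawing,
      isSimple_straightDiagonals, straightDiagonals.isCircular_drawing, P, hP, rfl⟩ ?_)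
    rintro k ⟨D, hS, hD, P, hP, rfl⟩
    have h0 := GraphDrawing.card_ne_zero_of_isBundling hD hP
    have h1 := GraphDrawing.card_ne_one_of_isBundling hS hD hP
    omega
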